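/- **Setting.** A *tile* is a closed unit square in $\mathbb{R}^2$ together with one of four colours (black, dark grey, light grey, white) and an arrow from one vertex of the square to the opposite vertex. Maps of the plane act on tiles by moving square and arrow and keeping the colour. Let $Q=[-1,1]^2$, and let $R_0$ be $Q$ divided into its four unit squares $[-1,0]\times[0,1]$ (black), $[-1,0]\times[-1,0]$ (dark grey), $[0,1]\times[0,1]$ (light grey), $[0,1]\times[-1,0]$ (white), each carrying the arrow that points from the origin to the vertex of $Q$ in that square. These four tiles are the *prototiles*. A *tiling* is a set of tiles congruent to prototiles that covers $\mathbb{R}^2$ and in which distinct tiles have disjoint interiors. For a set $\mathcal{T}$ of tiles and $t\in\mathbb{R}^2$ let $\mathcal{T}+t$ be its translate, let $B_r(x)$ be the open ball of radius $r$ and centre $x$, $B_r=B_r(0)$, and let $\mathcal{T}\cap B_r(x)=\{T\in\mathcal{T} : T\subset B_r(x)\}$. A *patch* of $\mathcal{T}$ is a finite subset of $\mathcal{T}$. **The arrowed tiling.** Let $\phi$ be the rotation through $-\pi/2$ about the origin. Let $P_0$ be the stack consisting of the single decorated square $R_0$. For $n\ge 1$ let $P_n$ be the stack of decorated squares consisting,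 from top to bottom, of $P_{n-1}+(-2^{n-1},0)$, $\phi P_{n-1}+(0,2^{n-1})$, $\phi^2P_{n-1}+(2^{n-1},0)$, $\phi^3P_{n-1}+(0,-2^{n-1})$, where each of the four copies keeps its inner above-below order. Let $R_n$ be the set of tiles of $P_n$ visible from above, that is, those tiles of the large squares in $P_n$ that are not covered by a large square lying higher in $P_n$. On each bounded region the patches $R_n$ are eventually constant; the *arrowed tiling* $\mathcal{A}$ is their limit, i.e. the set of all tiles that belong to $R_n$ for all sufficiently large $n$. **The hull.** For sets of tiles $\mathcal{T},\mathcal{T}'$ let $$\widetilde d(\mathcal{T},\mathcal{T}')=\inf\{\varepsilon>0 : \exists x,y\in B_\varepsilon:\ (\mathcal{T}+x)\cap B_{1/\varepsilon}=(\mathcal{T}'+y)\cap B_{1/\varepsilon}\},\qquad d=\min\{\widetilde d,1/\sqrt2\}.$$ The hull $\mathbb{X}(\mathcal{A})$ is the closure of $\{\mathcal{A}+t : t\in\mathbb{R}^2\}$ with respect to $d$ in the space of all tilings. **Statement.** Every $\mathcal{T}\in\mathbb{X}(\mathcal{A})$ 1. is *linearly repetitive*: there is a function $R:(0,\infty)\to(0,\infty)$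 with $R(r)=O(r)$ as $r\to\infty$ such that for all $r>0$, $s<r$ and $x,y\in\mathbb{R}^2$ a translate of the patch $\mathcal{T}\cap B_s(y)$ is contained in $\mathcal{T}\cap B_{R(r)}(x)$; and 2. has *uniform patch frequencies*: for every patch $P$ of $\mathcal{T}$, with $N_P(B_r(x))$ the number of congruent copies of $P$ contained in $\mathcal{T}\cap B_r(x)$, the limit $\lim_{r\to\infty}\frac{1}{\pi r^2}N_P(B_r(x))$ exists uniformly in $x\in\mathbb{R}^2$ and does not depend on $x$. -/

import Mathlib

namespace InductiveRotation

/-- The Euclidean plane. -/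
abbrev Plane : Type := EuclideanSpace ℝ (Fin 2)

/-- The four colours of the decorated unit squares. -/
inductive Colour : Type
  | black
  | darkGrey
  | lightGrey
  | white

/-- A decorated tile: a subset of the plane, a colour, and an arrow given by its two end points. -/
@[ext]
structure Tile : Type where
  support : Set Plane
  colour : Colour
  tail : Plane
  head : Plane

/-- The image of a decorated tile under a map of the plane: shape and arrow are moved, the colour
is kept. -/
def Tile.map (f : Plane → Plane) (τ : Tile) : Tile where
  support := f '' τ.support
  colour := τ.colour
  tail := f τ.tail
  head := f τ.head

/-- The translate `T + t` of a set of tiles. -/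
def translate (T : Set Tile) (t : Plane) : Set Tile :=
  Tile.map (fun v => v + t) '' T

/-- `T ∩ B_r(x)`: the tiles of `T` that are contained in the open ball `B_r(x)`. -/
def ballPatch (T : Set Tile) (x : Plane) (r : ℝ) : Set Tile :=
  {τ ∈ T | τ.support ⊆ Metric.ball x r}

/-! ### The decorated square and its four quadrants -/

/-- The large square `[-1,1]²`. -/
def largeSquare : Set Plane :=
  {v | ∀ k, v k ∈ Set.Icc (-1 : ℝ) 1}

/-- The vertex of the large square that lies in the quadrant of the given colour. -/
noncomputable def outerVertex : Colour → Plane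
  | .black => !₂[-1, 1]
  | .darkGrey => !₂[-1, -1]
  | .lightGrey => !₂[1, 1]
  | .white => !₂[1, -1]

/-- The four prototiles: the decorated large square is divided into four unit squares of distinct
colours, and each of them carries the arrow that points from the centre of the large square to the
vertex of the large square in that quadrant. -/
noncomputable def prototile (c : Colour) : Tile where
  support := {v | ∀ k, v k ∈ Set.uIcc 0 (outerVertex c k)}
  colour := c
  tail := 0
  head := outerVertex c

/-- A tiling of the plane by decorated unit squares: every tile is congruent to a prototile, the
tiles cover the plane, and distinct tiles have disjoint interiors. -/
def IsTiling (T : Set Tile) : Prop :=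
  (∀ τ ∈ T, ∃ c : Colour, ∃ f : Plane → Plane, Isometry f ∧ τ = (prototile c).map f) ∧
  (⋃ τ ∈ T, τ.support) = Set.univ ∧
  ∀ τ ∈ T, ∀ τ' ∈ T, τ ≠ τ' → Disjoint (interior τ.support) (interior τ'.support)

/-! ### The inductive rotation -/

/-- The rotation through `-π/2` about the origin. -/
noncomputable def rot (v : Plane) : Plane := !₂[v 1, -v 0]

/-- The `n`-th stack of overlapping large squares, listed from top to bottom. Each square is
represented by the motion that carries the original decorated square to it. Stack `n + 1` consists
of four copies of stack `n`: one moved to the left by `2 ^ n`, below it one rotated by `-π/2` and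
moved up, below it one rotated by `-π` and moved to the right, and at the bottom one rotated by
`-3π/2` and moved down. -/
noncomputable def stack : ℕ → List (Plane → Plane)
  | 0 => [id]
  | n + 1 =>
      (stack n).map (fun f v => f v + !₂[-(2 : ℝ) ^ n, 0]) ++
      (stack n).map (fun f v => rot (f v) + !₂[0, (2 : ℝ) ^ n]) ++
      (stack n).map (fun f v => rot (rot (f v)) + !₂[(2 : ℝ) ^ n, 0]) ++
      (stack n).map (fun f v => rot (rot (rot (f v))) + !₂[0, -(2 : ℝ) ^ n])

/-- What is seen of the `n`-th stack from above: the decorated unit squares of the large squares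
`f` of the stack that are not covered by a large square `g` lying above `f`. -/
def visible (n : ℕ) : Set Tile :=
  {τ | ∃ (above : List (Plane → Plane)) (f : Plane → Plane) (below : List (Plane → Plane)),
    stack n = above ++ f :: below ∧
    (∃ c : Colour, τ = (prototile c).map f) ∧
    ∀ g ∈ above, ¬ τ.support ⊆ g '' largeSquare}

/-- The arrowed tiling, the limit of the patches `visible n` in the local topology. On every
bounded region these patches are eventually constant, so that the limit consists of the tiles that
belong to all but finitely many of them. -/
def arrowedTiling : Set Tile :=
  {τ | ∀ᶠ n in Filter.atTop, τ ∈ visible n}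

/-! ### The hull -/

/-- The infimum of all `ε > 0` such that the two tilings agree in the ball of radius `1 / ε` about
the origin after translations by less than `ε`. -/
noncomputable def tilingPreDist (T T' : Set Tile) : ℝ :=
  sInf {ε : ℝ | 0 < ε ∧ ∃ x ∈ Metric.ball (0 : Plane) ε, ∃ y ∈ Metric.ball (0 : Plane) ε,
    ballPatch (translate T x) 0 (1 / ε) = ballPatch (translate T' y) 0 (1 / ε)}

/-- The tiling metric. -/
noncomputable def tilingDist (T T' : Set Tile) : ℝ :=
  min (tilingPreDist T T') (1 / √2)

/-- The hull of `T`: the closure, with respect to the tiling metric, of the set of all translates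
of `T` in the space of all tilings. -/
def hull (T : Set Tile) : Set (Set Tile) :=
  {T' | IsTiling T' ∧ ∀ δ > 0, ∃ t : Plane, tilingDist (translate T t) T' < δ}

/-! ### Linear repetitivity and uniform patch frequencies -/

/-- `T` is linearly repetitive: there is a function `R` with `R(r) = O(r)` such that for each
`r > 0`, every patch `T ∩ B_s(y)` with `s < r` occurs, up to a translation, in every patch
`T ∩ B_{R(r)}(x)`. -/
def LinearlyRepetitive (T : Set Tile) : Prop :=
  ∃ R : ℝ → ℝ,
    (∀ r > 0, 0 < R r ∧ ∀ s < r, ∀ y x : Plane, ∃ t : Plane,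
      translate (ballPatch T y s) t ⊆ ballPatch T x (R r)) ∧
    R =O[Filter.atTop] (fun r => r)

/-- The number of congruent copies of the patch `P` in `T ∩ B_r(x)`. -/
noncomputable def copyCount (T P : Set Tile) (x : Plane) (r : ℝ) : ℕ :=
  Set.ncard {P' : Set Tile | P' ⊆ ballPatch T x r ∧
    ∃ f : Plane → Plane, Isometry f ∧ P' = Tile.map f '' P}

/-- `T` has uniform patch frequencies: for each patch (finite subset) `P` of `T`, the number of
congruent copies of `P` in `T ∩ B_r(x)`, divided by `π r²`, converges as `r → ∞`, uniformly in
`x`. -/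
def UniformPatchFrequencies (T : Set Tile) : Prop :=
  ∀ P : Set Tile, P.Finite → P ⊆ T → ∃ freq : ℝ,
    TendstoUniformly (fun (r : ℝ) (x : Plane) => (copyCount T P x r : ℝ) / (Real.pi * r ^ 2))
      (fun _ => freq) Filter.atTop

end InductiveRotation

namespace InductiveRotation

/-! ### Which of two adjacent large squares lies on top -/

/-! The centres of the large squares form a lattice indexed by `ℤ²` (see `centre`). Squares with
adjacent indices overlap in exactly one unit square, which lies in no third large square. Hence unit
squares of the plane correspond to edges of the grid `ℤ²`, and the arrowed tiling amounts to
deciding, for each edge, which end lies on top (`topU`, `topV`). The upper end carries the tail of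
the arrow, and the parities of its index determine the colour (`turns`).

In indices, the four copies forming the next stack are successive quarter turns of an index square.
The resulting comparisons form a Toeplitz-like pattern: on odd lines they depend on residues modulo
4, and the even lines repeat the whole pattern at twice the scale. So on lines not divisible by `2 ^
(k + 1)` they are periodic modulo `2 ^ (k + 2)` (`topU_add_period`, `topV_add_period`).

Linear repetitivity: a patch of radius `r` fits into the four index squares of side `2 ^ K`,
comparable to `r`, around a vertex `(2 ^ K * a, 2 ^ K * b)`. Off the cross through this vertex the
pattern has period `2 ^ (K + 1)`; on the cross it is given by four bits. These bits recur on a full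
residue class of vertices modulo 32, with the parities of `a` and `b` preserved
(`exists_sameTops_of_parity`), so a copy occurs within a distance proportional to `2 ^ K`.

Frequencies: the lattice translations carrying a given patch into the tiling form a limit periodic
set, which is periodic up to finitely many families of lines of total density `O(2 ^ (-k))`. Such
sets have uniform densities (`IsLimitPeriodic.exists_hasUniformDensity`). Up to lattice translations
a patch has only finitely many relevant congruent copies, so the densities add up.

Hull: every ball patch of an element of the hull is a translate of a ball patch of the arrowed
tiling (`exists_ballPatch_eq_of_mem_hull`), and the estimates are uniform in the centre of the ball.
-/

/-- The comparison rule across the edge between `(a - 1, w)` and `(a, w)` for odd `a`. -/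
def oddRuleU (a w : ℤ) : Prop := w % 4 = 2 ∨ (a % 4 = 1 ∧ (w % 4 = 0 ∨ w % 4 = 3))

/-- The comparison rule across the edge between `(w, b - 1)` and `(w, b)` for odd `b`. -/
def oddRuleV (w b : ℤ) : Prop := w % 4 = 1 ∨ (b % 4 = 1 ∧ (w % 4 = 0 ∨ w % 4 = 3))

/-- The large square with index `(a - 1, w)` lies above the one with index `(a, w)`. -/
def topU (a w : ℤ) : Prop :=
  if a = 0 then w < 0 else oddRuleU (a / 2 ^ padicValInt 2 a) (w / 2 ^ padicValInt 2 a)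

/-- The large square with index `(w, b - 1)` lies above the one with index `(w, b)`. -/
def topV (w b : ℤ) : Prop :=
  if b = 0 then True else oddRuleV (w / 2 ^ padicValInt 2 b) (b / 2 ^ padicValInt 2 b)

theorem padicValInt_two_mul {a : ℤ} (ha : a ≠ 0) :
    padicValInt 2 (2 * a) = padicValInt 2 a + 1 := by
  have h2 : padicValInt 2 2 = 1 := padicValInt.self (p := 2) (by norm_num)
  rw [padicValInt.mul (by norm_num) ha, h2, add_comm]

theorem two_mul_ediv_two_pow_succ (a : ℤ) (k : ℕ) : 2 * a / 2 ^ (k + 1) = a / 2 ^ k := by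
  rw [pow_succ', Int.mul_ediv_mul_of_pos _ _ (by norm_num)]

theorem ediv_two_pow_succ (a : ℤ) (k : ℕ) : a / 2 ^ (k + 1) = a / 2 / 2 ^ k := by
  rw [pow_succ', Int.ediv_ediv_of_nonneg (by norm_num)]

theorem topU_zero (w : ℤ) : topU 0 w ↔ w < 0 := by simp [topU]

theorem topV_zero (w : ℤ) : topV w 0 := by simp [topV]

/-- Self-similarity. The exceptional line `a = 0` is compatible with it because floor division by 2
preserves the sign condition `w < 0`. -/
theorem topU_two_mul (a w : ℤ) : topU (2 * a) w ↔ topU a (w / 2) := by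
  by_cases ha : a = 0
  · subst ha
    simp only [mul_zero, topU_zero]
    omega
  · simp only [topU, if_neg ha, if_neg (show 2 * a ≠ 0 by omega), padicValInt_two_mul ha,
      two_mul_ediv_two_pow_succ, ediv_two_pow_succ w]

theorem topV_two_mul (w b : ℤ) : topV w (2 * b) ↔ topV (w / 2) b := by
  by_cases hb : b = 0
  · subst hb
    simp [topV_zero]
  · simp only [topV, if_neg hb, if_neg (show 2 * b ≠ 0 by omega), padicValInt_two_mul hb,
      two_mul_ediv_two_pow_succ, ediv_two_pow_succ w]

theorem topU_odd {a : ℤ} (ha : a % 2 = 1) (w : ℤ) : topU a w ↔ oddRuleU a w := by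
  have h : padicValInt 2 a = 0 := padicValInt.eq_zero_of_not_dvd (by norm_num; omega)
  simp [topU, h, show a ≠ 0 by omega]

theorem topV_odd {b : ℤ} (hb : b % 2 = 1) (w : ℤ) : topV w b ↔ oddRuleV w b := by
  have h : padicValInt 2 b = 0 := padicValInt.eq_zero_of_not_dvd (by norm_num; omega)
  simp [topV, h, show b ≠ 0 by omega]

theorem even_or_odd_of_int (a : ℤ) : (∃ a', a = 2 * a') ∨ a % 2 = 1 := by
  rcases Int.emod_two_eq_zero_or_one a with h | h
  · exact Or.inl ⟨a / 2, by omega⟩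
  · exact Or.inr h

theorem not_two_pow_dvd_half {k : ℕ} {a : ℤ} (h : ¬ (2 : ℤ) ^ (k + 1 + 1) ∣ 2 * a) :
    ¬ (2 : ℤ) ^ (k + 1) ∣ a := fun h' => h (by
  rw [pow_succ' _ (k + 1)]; exact mul_dvd_mul_left 2 h')

theorem odd_of_not_two_pow_one_dvd {a : ℤ} (h : ¬ (2 : ℤ) ^ (0 + 1) ∣ a) : a % 2 = 1 := by
  norm_num at h
  omega

theorem two_pow_mul_eq_four_mul (k : ℕ) (x : ℤ) : (2 : ℤ) ^ (k + 2) * x = 4 * (2 ^ k * x) := by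
  ring

/-- Halving lowers `k` until the line is odd, where the rule sees only residues modulo 4. -/
theorem topU_add_period (k : ℕ) (a w x y : ℤ) (h : ¬ (2 : ℤ) ^ (k + 1) ∣ a) :
    topU (a + 2 ^ (k + 2) * x) (w + 2 ^ (k + 2) * y) ↔ topU a w := by
  induction k generalizing a w with
  | zero =>
    have ha := odd_of_not_two_pow_one_dvd h
    rw [topU_odd ha, topU_odd (by omega)]
    unfold oddRuleU
    omega
  | succ k ih =>
    rcases even_or_odd_of_int a with ⟨a', rfl⟩ | ha
    · have e : 2 * a' + 2 ^ (k + 1 + 2) * x = 2 * (a' + 2 ^ (k + 2) * x) := by ring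
      have e' : (w + 2 ^ (k + 1 + 2) * y) / 2 = w / 2 + 2 ^ (k + 2) * y := by
        rw [show (2 : ℤ) ^ (k + 1 + 2) * y = 2 * (2 ^ (k + 2) * y) by ring]
        omega
      rw [e, topU_two_mul, topU_two_mul, e', ih _ _ (not_two_pow_dvd_half h)]
    · rw [two_pow_mul_eq_four_mul, two_pow_mul_eq_four_mul, topU_odd ha, topU_odd (by omega)]
      unfold oddRuleU
      omega

theorem topV_add_period (k : ℕ) (w b x y : ℤ) (h : ¬ (2 : ℤ) ^ (k + 1) ∣ b) :
    topV (w + 2 ^ (k + 2) * x) (b + 2 ^ (k + 2) * y) ↔ topV w b := by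
  induction k generalizing b w with
  | zero =>
    have hb := odd_of_not_two_pow_one_dvd h
    rw [topV_odd hb, topV_odd (by omega)]
    unfold oddRuleV
    omega
  | succ k ih =>
    rcases even_or_odd_of_int b with ⟨b', rfl⟩ | hb
    · have e : 2 * b' + 2 ^ (k + 1 + 2) * y = 2 * (b' + 2 ^ (k + 2) * y) := by ring
      have e' : (w + 2 ^ (k + 1 + 2) * x) / 2 = w / 2 + 2 ^ (k + 2) * x := by
        rw [show (2 : ℤ) ^ (k + 1 + 2) * x = 2 * (2 ^ (k + 2) * x) by ring]
        omega
      rw [e, topV_two_mul, topV_two_mul, e', ih _ _ (not_two_pow_dvd_half h)]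
    · rw [two_pow_mul_eq_four_mul, two_pow_mul_eq_four_mul, topV_odd hb, topV_odd (by omega)]
      unfold oddRuleV
      omega

/-- Invariance under quarter turns. The turn keeps the coordinate order of the two ends of a `topU`
edge and reverses that of a `topV` edge, whence the negation in `topU_rotate`. The divisibility
hypothesis excludes the lines separating the four copies, where the symmetry fails. -/
theorem topV_rotate (k : ℕ) (a w x : ℤ) (h : ¬ (2 : ℤ) ^ (k + 1) ∣ a) :
    topV (2 ^ (k + 2) * x - 1 - w) a ↔ topU a w := by
  induction k generalizing a w with
  | zero =>
    have ha := odd_of_not_two_pow_one_dvd h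
    rw [topU_odd ha, topV_odd ha]
    unfold oddRuleU oddRuleV
    omega
  | succ k ih =>
    rcases even_or_odd_of_int a with ⟨a', rfl⟩ | ha
    · have e' : (2 ^ (k + 1 + 2) * x - 1 - w) / 2 = 2 ^ (k + 2) * x - 1 - w / 2 := by
        rw [show (2 : ℤ) ^ (k + 1 + 2) * x = 2 * (2 ^ (k + 2) * x) by ring]
        omega
      rw [topU_two_mul, topV_two_mul, e', ih _ _ (not_two_pow_dvd_half h)]
    · rw [two_pow_mul_eq_four_mul, topU_odd ha, topV_odd ha]
      unfold oddRuleU oddRuleV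
      omega

theorem topU_rotate (k : ℕ) (w b x : ℤ) (h : ¬ (2 : ℤ) ^ (k + 1) ∣ b) :
    topU (2 ^ (k + 2) * x - b) w ↔ ¬ topV w b := by
  induction k generalizing b w with
  | zero =>
    have hb := odd_of_not_two_pow_one_dvd h
    rw [topU_odd (by omega), topV_odd hb]
    unfold oddRuleU oddRuleV
    omega
  | succ k ih =>
    rcases even_or_odd_of_int b with ⟨b', rfl⟩ | hb
    · have e : 2 ^ (k + 1 + 2) * x - 2 * b' = 2 * (2 ^ (k + 2) * x - b') := by ring
      rw [e, topU_two_mul, topV_two_mul, ih _ _ (not_two_pow_dvd_half h)]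
    · rw [two_pow_mul_eq_four_mul, topV_odd hb, topU_odd (by omega)]
      unfold oddRuleU oddRuleV
      omega

theorem topU_two_pow_mul (K : ℕ) (a w : ℤ) : topU (2 ^ K * a) w ↔ topU a (w / 2 ^ K) := by
  induction K generalizing w with
  | zero => simp
  | succ K ih => rw [show (2 : ℤ) ^ (K + 1) * a = 2 * (2 ^ K * a) by ring, topU_two_mul, ih,
      ediv_two_pow_succ]

theorem topV_two_pow_mul (K : ℕ) (w b : ℤ) : topV w (2 ^ K * b) ↔ topV (w / 2 ^ K) b := by
  induction K generalizing w with
  | zero => simp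
  | succ K ih => rw [show (2 : ℤ) ^ (K + 1) * b = 2 * (2 ^ K * b) by ring, topV_two_mul, ih,
      ediv_two_pow_succ]

theorem ediv_eq_of_mul_le_of_lt {w M q : ℤ} (h : M * q ≤ w) (h' : w < M * q + M) :
    w / M = q := by
  have hM : 0 < M := by linarith
  rw [Int.ediv_eq_iff_of_pos hM]
  constructor <;> linarith

/-- With `topV_two_pow`, this encodes the stacking order of the four quadrants: `(0,0)`, `(1,0)`,
`(1,1)`, `(0,1)` from top to bottom. -/
theorem topU_two_pow (n : ℕ) {w : ℤ} (h0 : 0 ≤ w) (h1 : w < 2 * 2 ^ n) :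
    topU (2 ^ n) w ↔ w < 2 ^ n := by
  rw [← mul_one ((2 : ℤ) ^ n), topU_two_pow_mul, topU_odd (by norm_num), mul_one]
  by_cases h : w < 2 ^ n
  · rw [ediv_eq_of_mul_le_of_lt (q := 0) (by linarith) (by linarith)]
    simp [oddRuleU, h]
  · rw [ediv_eq_of_mul_le_of_lt (q := 1) (by linarith) (by linarith)]
    simp [oddRuleU, h]

theorem topV_two_pow (n : ℕ) {w : ℤ} (h0 : 0 ≤ w) (h1 : w < 2 * 2 ^ n) : topV w (2 ^ n) := by
  rw [← mul_one ((2 : ℤ) ^ n), topV_two_pow_mul, topV_odd (by norm_num)]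
  by_cases h : w < 2 ^ n
  · rw [ediv_eq_of_mul_le_of_lt (q := 0) (by linarith) (by linarith)]
    simp [oddRuleV]
  · rw [ediv_eq_of_mul_le_of_lt (q := 1) (by linarith) (by linarith)]
    simp [oddRuleV]

theorem not_two_pow_dvd_of_abs_lt {a : ℤ} {n : ℕ} (ha : a ≠ 0) (h : |a| < 2 ^ n) :
    ¬ (2 : ℤ) ^ n ∣ a := fun hd => ha (Int.eq_zero_of_abs_lt_dvd hd h)

/-- The reason for the value of `topU` at `a = 0`: it is the rule on the middle line of a finite
stack once the centre is moved to the origin. The other lines follow by periodicity. -/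
theorem topU_add_two_pow (n : ℕ) {a w : ℤ} (ha : |a| < 2 ^ n) (hw : |w| < 2 ^ n) :
    topU (a + 2 ^ (n + 1)) (w + 2 ^ (n + 1)) ↔ topU a w := by
  have hw' := abs_lt.1 hw
  by_cases h0 : a = 0
  · subst h0
    have := pow_succ (2 : ℤ) n
    rw [zero_add, topU_two_pow _ (by linarith) (by linarith), topU_zero]
    omega
  · obtain _ | n := n
    · exact absurd (by simpa using ha) h0
    · have := topU_add_period n a w 1 1 (not_two_pow_dvd_of_abs_lt h0 ha)
      simpa using this

theorem topV_add_two_pow (n : ℕ) {w b : ℤ} (hb : |b| < 2 ^ n) (hw : |w| < 2 ^ n) :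
    topV (w + 2 ^ (n + 1)) (b + 2 ^ (n + 1)) ↔ topV w b := by
  have hw' := abs_lt.1 hw
  by_cases h0 : b = 0
  · subst h0
    have := pow_succ (2 : ℤ) n
    rw [zero_add]
    exact iff_of_true (topV_two_pow _ (by linarith) (by linarith)) (topV_zero w)
  · obtain _ | n := n
    · exact absurd (by simpa using hb) h0
    · have := topV_add_period n w b 1 1 (not_two_pow_dvd_of_abs_lt h0 hb)
      simpa using this

/-! ### The stacks in integer coordinates -/

/-- The four neighbours of a point of the integer grid. -/
def neighbour (z : ℤ × ℤ) : Fin 4 → ℤ × ℤ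
  | 0 => (z.1, z.2 - 1)
  | 1 => (z.1 + 1, z.2)
  | 2 => (z.1, z.2 + 1)
  | 3 => (z.1 - 1, z.2)

/-- The large square with index `z` lies above its neighbour in direction `e`. -/
def Wins (z : ℤ × ℤ) : Fin 4 → Prop
  | 0 => ¬ topV z.1 z.2
  | 1 => topU (z.1 + 1) z.2
  | 2 => topV z.1 (z.2 + 1)
  | 3 => ¬ topU z.1 z.2

/-- The quarter turn of the index square of side `2 ^ (n + 1)`. -/
def quarterTurn (n : ℕ) (z : ℤ × ℤ) : ℤ × ℤ := (2 ^ (n + 1) - 1 - z.2, z.1)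

/-- The inverse of `quarterTurn n`. -/
def quarterTurnInv (n : ℕ) (z : ℤ × ℤ) : ℤ × ℤ := (z.2, 2 ^ (n + 1) - 1 - z.1)

theorem quarterTurn_quarterTurnInv (n : ℕ) (z : ℤ × ℤ) :
    quarterTurn n (quarterTurnInv n z) = z := by
  ext <;> simp [quarterTurn, quarterTurnInv]

theorem quarterTurn_injective (n : ℕ) : Function.Injective (quarterTurn n) := by
  rintro ⟨a, b⟩ ⟨c, d⟩ h
  simp only [quarterTurn, Prod.mk.injEq] at h ⊢
  omega

theorem quarterTurn_neighbour (n : ℕ) (z : ℤ × ℤ) (e : Fin 4) :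
    quarterTurn n (neighbour z e) = neighbour (quarterTurn n z) (e + 1) := by
  fin_cases e <;> simp [neighbour, quarterTurn] <;> ring

/-- The indices of the large squares of the `n`-th stack, from top to bottom. -/
def centreStack : ℕ → List (ℤ × ℤ)
  | 0 => [(0, 0)]
  | n + 1 =>
      centreStack n ++
      ((centreStack n).map (quarterTurn n) ++
      (((centreStack n).map (quarterTurn n)).map (quarterTurn n) ++
      (((centreStack n).map (quarterTurn n)).map (quarterTurn n)).map (quarterTurn n)))

/-- `z` occurs in the list, preceded only by elements that satisfy `p`. -/
def OccursAfter {α : Type*} (p : α → Prop) (z : α) (l : List α) : Prop :=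
  ∃ above below, l = above ++ z :: below ∧ ∀ g ∈ above, p g

theorem occursAfter_nil {α : Type*} (p : α → Prop) (z : α) : ¬ OccursAfter p z [] := by
  rintro ⟨above, below, h, -⟩
  simp at h

theorem occursAfter_cons {α : Type*} (p : α → Prop) (z a : α) (l : List α) :
    OccursAfter p z (a :: l) ↔ a = z ∨ p a ∧ OccursAfter p z l := by
  constructor
  · rintro ⟨above, below, h, hp⟩
    rcases above with _ | ⟨b, above⟩
    · simp only [List.nil_append, List.cons.injEq] at h
      exact Or.inl h.1
    · simp only [List.cons_append, List.cons.injEq] at h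
      obtain ⟨rfl, rfl⟩ := h
      exact Or.inr ⟨hp _ (by simp), above, below, rfl, fun g hg => hp g (by simp [hg])⟩
  · rintro (rfl | ⟨ha, above, below, rfl, hp⟩)
    · exact ⟨[], l, rfl, by simp⟩
    · exact ⟨a :: above, below, rfl, by simpa using ⟨ha, hp⟩⟩

theorem occursAfter_append {α : Type*} (p : α → Prop) (z : α) (l l' : List α) :
    OccursAfter p z (l ++ l') ↔ OccursAfter p z l ∨ (∀ g ∈ l, p g) ∧ OccursAfter p z l' := by
  induction l with
  | nil => simp [occursAfter_nil]
  | cons a l ih =>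
    rw [List.cons_append, occursAfter_cons, occursAfter_cons, ih, List.forall_mem_cons]
    tauto

theorem occursAfter_map {α β : Type*} (f : α → β) (p : β → Prop) (z : β) (l : List α) :
    OccursAfter p z (l.map f) ↔ ∃ x, f x = z ∧ OccursAfter (fun g => p (f g)) x l := by
  induction l with
  | nil => simp [occursAfter_nil]
  | cons a l ih =>
    simp only [List.map_cons, occursAfter_cons, ih]
    constructor
    · rintro (h | ⟨hp, x, hx, h⟩)
      · exact ⟨a, h, Or.inl rfl⟩
      · exact ⟨x, hx, Or.inr ⟨hp, h⟩⟩
    · rintro ⟨x, rfl, rfl | ⟨hp, h⟩⟩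
      · exact Or.inl rfl
      · exact Or.inr ⟨hp, x, rfl, h⟩

/-- The index square of side `2 ^ n` in position `(s, t)`. -/
def InBox (n : ℕ) (s t : ℤ) (z : ℤ × ℤ) : Prop :=
  2 ^ n * s ≤ z.1 ∧ z.1 < 2 ^ n * s + 2 ^ n ∧ 2 ^ n * t ≤ z.2 ∧ z.2 < 2 ^ n * t + 2 ^ n

theorem inBox_quarterTurn (n : ℕ) (s t : ℤ) (z : ℤ × ℤ) :
    InBox n (1 - t) s (quarterTurn n z) ↔ InBox n s t z := by
  have h1 : (2 : ℤ) ^ n * (1 - t) = 2 ^ n - 2 ^ n * t := by ring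
  have h2 : (2 : ℤ) ^ (n + 1) = 2 * 2 ^ n := pow_succ' _ _
  simp only [InBox, quarterTurn, h1, h2]
  omega

theorem not_two_pow_dvd_of_between {n : ℕ} {s a : ℤ} (h : 2 ^ n * s < a)
    (h' : a < 2 ^ n * s + 2 ^ n) : ¬ (2 : ℤ) ^ n ∣ a := by
  rintro ⟨x, rfl⟩
  have h0 : (0 : ℤ) < 2 ^ n := by positivity
  have h1 : s < x := lt_of_mul_lt_mul_left h h0.le
  have h2 : x < s + 1 := lt_of_mul_lt_mul_left (by linarith) h0.le
  omega

/-- An edge with both ends in one box of side `2 ^ n` crosses a line not divisible by `2 ^ n`, so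
the rotation identities apply. -/
theorem wins_quarterTurn {n : ℕ} {s t : ℤ} {z : ℤ × ℤ} {e : Fin 4} (hz : InBox n s t z)
    (hn : InBox n s t (neighbour z e)) : Wins (quarterTurn n z) (e + 1) ↔ Wins z e := by
  obtain ⟨i, j⟩ := z
  have key : ∀ a c : ℤ, 2 ^ n * c < a → a < 2 ^ n * c + 2 ^ n →
      ∃ k, n = k + 1 ∧ ¬ (2 : ℤ) ^ (k + 1) ∣ a := by
    intro a c h h'
    obtain _ | k := n
    · simp at h h'
      omega
    · exact ⟨k, rfl, not_two_pow_dvd_of_between h h'⟩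
  simp only [InBox] at hz
  fin_cases e <;> simp [neighbour, InBox] at hn <;> simp [Wins, quarterTurn]
  · obtain ⟨k, rfl, hk⟩ := key j t (by omega) (by omega)
    have := topU_rotate k i j 1 hk
    rw [mul_one] at this
    rw [show (2 : ℤ) ^ (k + 1 + 1) - 1 - j + 1 = 2 ^ (k + 2) - j by ring]
    exact this
  · obtain ⟨k, rfl, hk⟩ := key (i + 1) s (by omega) (by omega)
    have := topV_rotate k (i + 1) j 1 hk
    rw [mul_one] at this
    exact this
  · obtain ⟨k, rfl, hk⟩ := key (j + 1) t (by omega) (by omega)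
    have := topU_rotate k i (j + 1) 1 hk
    rw [mul_one] at this
    rw [show (2 : ℤ) ^ (k + 1 + 1) - 1 - j = 2 ^ (k + 2) - (j + 1) by ring, this, not_not]
  · obtain ⟨k, rfl, hk⟩ := key i s (by omega) (by omega)
    have := topV_rotate k i j 1 hk
    rw [mul_one] at this
    exact not_congr this

/-- The list is a stacking, in the order given by `Wins`, of the index square of side `2 ^ n` in
position `(s, t)`. -/
def IsBoxStack (n : ℕ) (s t : ℤ) (l : List (ℤ × ℤ)) : Prop :=
  (∀ z, z ∈ l ↔ InBox n s t z) ∧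
  ∀ z e, OccursAfter (fun g => g ≠ z ∧ g ≠ neighbour z e) z l ↔
    InBox n s t z ∧ (InBox n s t (neighbour z e) → Wins z e)

theorem IsBoxStack.map_quarterTurn {n : ℕ} {s t : ℤ} {l : List (ℤ × ℤ)} (h : IsBoxStack n s t l) :
    IsBoxStack n (1 - t) s (l.map (quarterTurn n)) := by
  refine ⟨fun z => ?_, fun z e => ?_⟩
  · obtain ⟨z, rfl⟩ : ∃ w, z = quarterTurn n w := ⟨_, (quarterTurn_quarterTurnInv n z).symm⟩
    rw [List.mem_map_of_injective (quarterTurn_injective n), h.1, inBox_quarterTurn]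
  · obtain ⟨z, rfl⟩ : ∃ w, z = quarterTurn n w := ⟨_, (quarterTurn_quarterTurnInv n z).symm⟩
    obtain ⟨e, rfl⟩ : ∃ e', e = e' + 1 := ⟨e - 1, by simp⟩
    rw [occursAfter_map]
    simp only [(quarterTurn_injective n).eq_iff, exists_eq_left, ← quarterTurn_neighbour,
      (quarterTurn_injective n).ne_iff, h.2, inBox_quarterTurn]
    constructor
    · rintro ⟨h1, h2⟩
      exact ⟨h1, fun h3 => (wins_quarterTurn h1 h3).2 (h2 h3)⟩
    · rintro ⟨h1, h2⟩
      exact ⟨h1, fun h3 => (wins_quarterTurn h1 h3).1 (h2 h3)⟩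

/-- Within a copy the order is inherited through quarter turns; between copies the higher one wins,
as the values of `topU` and `topV` on the middle lines say. -/
theorem isBoxStack_centreStack (n : ℕ) : IsBoxStack n 0 0 (centreStack n) := by
  induction n with
  | zero =>
    refine ⟨fun z => ?_, fun z e => ?_⟩
    · simp [centreStack, InBox, Prod.ext_iff]
      omega
    · rw [centreStack, occursAfter_cons]
      simp only [occursAfter_nil, and_false, or_false]
      obtain ⟨i, j⟩ := z
      fin_cases e <;> simp [InBox, neighbour] <;> omega
  | succ n h00 =>
    have h10 := h00.map_quarterTurn
    have h11 := h10.map_quarterTurn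
    have h01 := h11.map_quarterTurn
    norm_num at h10 h11 h01
    have hp : (0 : ℤ) < 2 ^ n := by positivity
    have h2 : (2 : ℤ) ^ (n + 1) = 2 * 2 ^ n := pow_succ' _ _
    have hU := @topU_two_pow n
    have hV := @topV_two_pow n
    refine ⟨fun z => ?_, fun z e => ?_⟩
    · simp only [centreStack, List.mem_append, List.map_map, h00.1, h10.1, h11.1, h01.1, InBox, h2]
      omega
    -- A complete box lying above hides nothing of the edge exactly when it contains neither end.
    · have aux : ∀ s t : ℤ, (∀ g, InBox n s t g → g ≠ z ∧ g ≠ neighbour z e) ↔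
          ¬ InBox n s t z ∧ ¬ InBox n s t (neighbour z e) := by
        intro s t
        constructor
        · exact fun h => ⟨fun h1 => (h _ h1).1 rfl, fun h1 => (h _ h1).2 rfl⟩
        · rintro ⟨h1, h2⟩ g hg
          exact ⟨fun h => h1 (h ▸ hg), fun h => h2 (h ▸ hg)⟩
      simp only [centreStack, occursAfter_append, List.map_map, h00.1, h10.1, h11.1,
        h00.2, h10.2, h11.2, h01.2, aux]
      obtain ⟨i, j⟩ := z
      -- For each direction the comparison becomes an opaque proposition `W`; only its value on the
      -- middle line is needed.
      fin_cases e <;> simp only [InBox, neighbour, h2] <;> simp [Wins]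
      · have hW : j = 2 ^ n → 0 ≤ i → i < 2 * 2 ^ n → topV i j := by
          rintro rfl h h'
          exact hV h h'
        clear aux hU hV h00 h10 h11 h01 h2
        generalize (2 : ℤ) ^ n = M at *
        generalize topV i j = W at *
        rcases lt_or_ge i M with h3 | h3 <;> rcases lt_or_ge j M with h4 | h4 <;> grind
      · have hW : i + 1 = 2 ^ n → 0 ≤ j → j < 2 * 2 ^ n → (topU (i + 1) j ↔ j < 2 ^ n) := by
          intro h
          rw [h]
          exact hU
        clear aux hU hV h00 h10 h11 h01 h2
        generalize (2 : ℤ) ^ n = M at *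
        generalize topU (i + 1) j = W at *
        rcases lt_or_ge i M with h3 | h3 <;> rcases lt_or_ge j M with h4 | h4 <;> grind
      · have hW : j + 1 = 2 ^ n → 0 ≤ i → i < 2 * 2 ^ n → topV i (j + 1) := by
          intro h
          rw [h]
          exact hV
        clear aux hU hV h00 h10 h11 h01 h2
        generalize (2 : ℤ) ^ n = M at *
        generalize topV i (j + 1) = W at *
        rcases lt_or_ge i M with h3 | h3 <;> rcases lt_or_ge j M with h4 | h4 <;> grind
      · have hW : i = 2 ^ n → 0 ≤ j → j < 2 * 2 ^ n → (topU i j ↔ j < 2 ^ n) := by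
          rintro rfl h h'
          exact hU h h'
        clear aux hU hV h00 h10 h11 h01 h2
        generalize (2 : ℤ) ^ n = M at *
        generalize topU i j = W at *
        rcases lt_or_ge i M with h3 | h3 <;> rcases lt_or_ge j M with h4 | h4 <;> grind

/-! ### The tiles of the stacks -/

/-- The rotation, as a number of quarter turns, of the large square with index `z`. -/
def turns (z : ℤ × ℤ) : Fin 4 :=
  if z.1 % 2 = 0 then (if z.2 % 2 = 0 then 0 else 3) else (if z.2 % 2 = 0 then 1 else 2)

/-- The four diagonal directions, in clockwise order. -/
noncomputable def diagonal : Fin 4 → Plane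
  | 0 => !₂[-1, 1]
  | 1 => !₂[1, 1]
  | 2 => !₂[1, -1]
  | 3 => !₂[-1, -1]

/-- The direction of the arrow of the prototile of the given colour. -/
def colourIndex : Colour → Fin 4
  | .black => 0
  | .lightGrey => 1
  | .white => 2
  | .darkGrey => 3

/-- The colour of the prototile whose arrow has the given direction. -/
def colourOf : Fin 4 → Colour
  | 0 => .black
  | 1 => .lightGrey
  | 2 => .white
  | 3 => .darkGrey

theorem colourOf_colourIndex (c : Colour) : colourOf (colourIndex c) = c := by cases c <;> rfl

theorem colourIndex_colourOf (e : Fin 4) : colourIndex (colourOf e) = e := by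
  fin_cases e <;> rfl

/-- The tile with an arrow that starts in `p` and has the given direction and colour. -/
noncomputable def arrowTile (p : Plane) (e : Fin 4) (c : Colour) : Tile where
  support := {v | ∀ k, v k ∈ Set.uIcc (p k) ((p + diagonal e) k)}
  colour := c
  tail := p
  head := p + diagonal e

theorem prototile_eq_arrowTile (c : Colour) : prototile c = arrowTile 0 (colourIndex c) c := by
  cases c <;> simp [prototile, arrowTile, outerVertex, colourIndex, diagonal]

theorem rot_apply_zero (v : Plane) : rot v 0 = v 1 := rfl

theorem rot_apply_one (v : Plane) : rot v 1 = -v 0 := rfl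

theorem plane_ext {v w : Plane} (h0 : v 0 = w 0) (h1 : v 1 = w 1) : v = w := by
  ext k
  fin_cases k
  · exact h0
  · exact h1

theorem rot_add (v w : Plane) : rot (v + w) = rot v + rot w := by
  apply plane_ext <;> simp [rot_apply_zero, rot_apply_one]
  ring

theorem rot_rot_rot_rot (v : Plane) : rot (rot (rot (rot v))) = v := by
  apply plane_ext <;> simp [rot_apply_zero, rot_apply_one]

theorem rot_zero : rot 0 = 0 := by
  apply plane_ext <;> simp [rot_apply_zero, rot_apply_one]

theorem rot_diagonal (e : Fin 4) : rot (diagonal e) = diagonal (e + 1) := by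
  fin_cases e <;> apply plane_ext <;> simp [rot_apply_zero, rot_apply_one, diagonal]

theorem mem_image_rot (S : Set Plane) (v : Plane) : v ∈ rot '' S ↔ rot (rot (rot v)) ∈ S := by
  constructor
  · rintro ⟨w, hw, rfl⟩
    rwa [rot_rot_rot_rot]
  · exact fun h => ⟨_, h, rot_rot_rot_rot v⟩

theorem mem_image_add (S : Set Plane) (t v : Plane) : v ∈ (fun v => v + t) '' S ↔ v - t ∈ S := by
  constructor
  · rintro ⟨w, hw, rfl⟩
    simpa using hw
  · exact fun h => ⟨_, h, sub_add_cancel v t⟩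

theorem arrowTile_map_rot (p : Plane) (e : Fin 4) (c : Colour) :
    (arrowTile p e c).map rot = arrowTile (rot p) (e + 1) c := by
  have hd : rot p + diagonal (e + 1) = rot (p + diagonal e) := by rw [rot_add, rot_diagonal]
  simp only [arrowTile, Tile.map, hd, Tile.mk.injEq, and_true]
  ext v
  rw [mem_image_rot]
  simp only [Set.mem_ofPred_eq, Fin.forall_fin_two, rot_apply_zero, rot_apply_one, Set.mem_uIcc]
  grind

theorem arrowTile_map_add (p t : Plane) (e : Fin 4) (c : Colour) :
    (arrowTile p e c).map (fun v => v + t) = arrowTile (p + t) e c := by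
  have hd : p + t + diagonal e = p + diagonal e + t := by abel
  simp only [arrowTile, Tile.map, hd, Tile.mk.injEq, and_true]
  ext v
  rw [mem_image_add]
  simp only [Set.mem_ofPred_eq, Fin.forall_fin_two, Set.mem_uIcc, PiLp.sub_apply, PiLp.add_apply]
  grind

theorem diagonal_injective : Function.Injective diagonal := by
  intro e e' h
  have h0 := congrFun (congrArg WithLp.ofLp h) 0
  have h1 := congrFun (congrArg WithLp.ofLp h) 1
  fin_cases e <;> fin_cases e' <;> first | rfl | (exfalso; simp [diagonal] at h0 h1; linarith)

theorem arrowTile_inj {p p' : Plane} {e e' : Fin 4} {c c' : Colour} :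
    arrowTile p e c = arrowTile p' e' c' ↔ p = p' ∧ e = e' ∧ c = c' := by
  constructor
  · intro h
    have h1 : p = p' := congrArg Tile.tail h
    have h2 : p + diagonal e = p' + diagonal e' := congrArg Tile.head h
    refine ⟨h1, ?_, congrArg Tile.colour h⟩
    rw [h1] at h2
    exact diagonal_injective (add_left_cancel h2)
  · rintro ⟨rfl, rfl, rfl⟩
    rfl

theorem Tile.map_map (f g : Plane → Plane) (τ : Tile) :
    (τ.map f).map g = τ.map (fun v => g (f v)) := by
  simp [Tile.map, Set.image_image]

theorem Tile.map_id (τ : Tile) : τ.map id = τ := by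
  simp [Tile.map]

/-- The centre of the large square with index `z`, with the origin moved to the left by `t`. -/
noncomputable def centre (t : ℝ) (z : ℤ × ℤ) : Plane := !₂[(z.1 : ℝ) + z.2 + 1 - t, z.1 - z.2]

theorem centre_zero (t : ℝ) (z : ℤ × ℤ) : centre t z 0 = z.1 + z.2 + 1 - t := rfl

theorem centre_one (t : ℝ) (z : ℤ × ℤ) : centre t z 1 = z.1 - z.2 := rfl

theorem centre_injective (t : ℝ) : Function.Injective (centre t) := by
  intro z z' h
  have h0 := congrFun (congrArg WithLp.ofLp h) 0
  have h1 := congrFun (congrArg WithLp.ofLp h) 1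
  simp only [centre_zero, centre_one] at h0 h1
  have h2 : (z.1 : ℝ) = z'.1 := by linarith
  have h3 : (z.2 : ℝ) = z'.2 := by linarith
  exact Prod.ext (by exact_mod_cast h2) (by exact_mod_cast h3)

/-- The motion that places the large square with index `z` in the `n`-th stack. -/
noncomputable def motion (n : ℕ) (z : ℤ × ℤ) (v : Plane) : Plane :=
  rot^[(turns z).val] v + centre (2 ^ n) z

theorem turns_quarterTurn (n : ℕ) (z : ℤ × ℤ) : turns (quarterTurn n z) = turns z + 1 := by
  have h2 : (2 : ℤ) ^ (n + 1) = 2 * 2 ^ n := pow_succ' _ _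
  simp only [turns, quarterTurn, h2]
  rcases Int.emod_two_eq_zero_or_one z.1 with h | h <;>
  rcases Int.emod_two_eq_zero_or_one z.2 with h' | h'
  · have : ¬ (2 * 2 ^ n - 1 - z.2) % 2 = 0 := by omega
    simp [h, h', this]
  · have : (2 * 2 ^ n - 1 - z.2) % 2 = 0 := by omega
    simp [h, h', this]
  · have : ¬ (2 * 2 ^ n - 1 - z.2) % 2 = 0 := by omega
    simp [h, h', this]
  · have : (2 * 2 ^ n - 1 - z.2) % 2 = 0 := by omega
    simp [h, h', this]

theorem iterate_rot_add_one (s : Fin 4) (v : Plane) :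
    rot^[(s + 1).val] v = rot (rot^[s.val] v) := by
  fin_cases s <;> simp [rot_rot_rot_rot]

theorem centre_quarterTurn (n : ℕ) (z : ℤ × ℤ) :
    rot (centre (2 ^ (n + 1)) z) = centre (2 ^ (n + 1)) (quarterTurn n z) := by
  apply plane_ext <;>
  simp only [rot_apply_zero, rot_apply_one, centre_zero, centre_one, quarterTurn] <;>
  push_cast <;> ring

theorem rot_motion (n : ℕ) (z : ℤ × ℤ) (v : Plane) :
    rot (motion (n + 1) z v) = motion (n + 1) (quarterTurn n z) v := by
  rw [motion, motion, rot_add, turns_quarterTurn, iterate_rot_add_one, centre_quarterTurn]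

theorem motion_succ (n : ℕ) (z : ℤ × ℤ) (v : Plane) :
    motion n z v + !₂[-(2 : ℝ) ^ n, 0] = motion (n + 1) z v := by
  rw [motion, motion, add_assoc]
  congr 1
  apply plane_ext <;> simp [centre_zero, centre_one]
  ring

/-- The translation vectors are rotated into one another, so each lower copy is the rotation about
the origin of the copy above it. In indices this rotation is `quarterTurn`. -/
theorem stack_eq_map_motion (n : ℕ) : stack n = (centreStack n).map (motion n) := by
  induction n with
  | zero =>
    simp only [stack, centreStack, List.map_cons, List.map_nil, List.cons.injEq, and_true]
    funext v
    apply plane_ext <;> simp [motion, turns, centre_zero, centre_one]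
  | succ n ih =>
    have r1 : rot !₂[-(2 : ℝ) ^ n, 0] = !₂[0, (2 : ℝ) ^ n] := by
      apply plane_ext <;> simp [rot_apply_zero, rot_apply_one]
    have r2 : rot !₂[0, (2 : ℝ) ^ n] = !₂[(2 : ℝ) ^ n, 0] := by
      apply plane_ext <;> simp [rot_apply_zero, rot_apply_one]
    have r3 : rot !₂[(2 : ℝ) ^ n, 0] = !₂[0, -(2 : ℝ) ^ n] := by
      apply plane_ext <;> simp [rot_apply_zero, rot_apply_one]
    simp only [stack, centreStack, ih, List.map_append, List.map_map, List.append_assoc]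
    congr 1
    · refine List.map_congr_left fun z _ => funext fun v => motion_succ n z v
    congr 1
    · refine List.map_congr_left fun z _ => funext fun v => ?_
      simp only [Function.comp_apply]
      rw [← rot_motion, ← motion_succ, rot_add, r1]
    congr 1
    · refine List.map_congr_left fun z _ => funext fun v => ?_
      simp only [Function.comp_apply]
      rw [← rot_motion, ← rot_motion, ← motion_succ, rot_add,
        rot_add, r1, r2]
    · refine List.map_congr_left fun z _ => funext fun v => ?_
      simp only [Function.comp_apply]
      rw [← rot_motion, ← rot_motion,
        ← rot_motion, ← motion_succ, rot_add, rot_add, rot_add, r1, r2, r3]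

theorem arrowTile_map_iterate_rot (p : Plane) (e s : Fin 4) (c : Colour) :
    (arrowTile p e c).map (rot^[s.val]) = arrowTile (rot^[s.val] p) (e + s) c := by
  have h : ∀ k : ℕ, (arrowTile p e c).map (rot^[k]) = arrowTile (rot^[k] p) (e + Fin.ofNat 4 k) c := by
    intro k
    induction k with
    | zero => simp [Tile.map_id]
    | succ k ih =>
      have e1 : rot^[k + 1] = fun v => rot (rot^[k] v) := by
        funext v
        rw [Function.iterate_succ_apply']
      rw [e1, ← Tile.map_map, ih, arrowTile_map_rot]
      congr 1
      ext
      simp [Fin.val_add, Fin.ofNat]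
      omega
  rw [h]
  simp

theorem prototile_map_motion (n : ℕ) (z : ℤ × ℤ) (c : Colour) :
    (prototile c).map (motion n z) = arrowTile (centre (2 ^ n) z) (colourIndex c + turns z) c := by
  have h0 : ∀ k : ℕ, rot^[k] 0 = 0 := fun k => Function.iterate_fixed rot_zero k
  have : motion n z = fun v => rot^[(turns z).val] v + centre (2 ^ n) z := rfl
  rw [this, ← Tile.map_map _ (fun v => v + centre (2 ^ n) z), prototile_eq_arrowTile,
    arrowTile_map_iterate_rot, arrowTile_map_add, h0, zero_add]

theorem image_rot_largeSquare : rot '' largeSquare = largeSquare := by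
  ext v
  rw [mem_image_rot]
  simp only [largeSquare, Set.mem_ofPred_eq, Fin.forall_fin_two, rot_apply_zero, rot_apply_one,
    Set.mem_Icc]
  grind

theorem mem_image_motion_largeSquare (n : ℕ) (z : ℤ × ℤ) (v : Plane) :
    v ∈ motion n z '' largeSquare ↔ v - centre (2 ^ n) z ∈ largeSquare := by
  have h : ∀ k : ℕ, rot^[k] '' largeSquare = largeSquare := by
    intro k
    induction k with
    | zero => simp
    | succ k ih => rw [Function.iterate_succ', Set.image_comp, ih, image_rot_largeSquare]
  have : motion n z '' largeSquare =
      (fun v => v + centre (2 ^ n) z) '' (rot^[(turns z).val] '' largeSquare) := by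
    rw [Set.image_image]
    rfl
  rw [this, mem_image_add, h]

theorem tail_mem_support (p : Plane) (e : Fin 4) (c : Colour) : p ∈ (arrowTile p e c).support :=
  fun _ => Set.left_mem_uIcc

theorem head_mem_support (p : Plane) (e : Fin 4) (c : Colour) :
    p + diagonal e ∈ (arrowTile p e c).support :=
  fun _ => Set.right_mem_uIcc

theorem centre_add_diagonal (t : ℝ) (z : ℤ × ℤ) (e : Fin 4) :
    centre t z + diagonal e = centre t (neighbour z e) := by
  fin_cases e <;> apply plane_ext <;>
  simp [centre_zero, centre_one, diagonal, neighbour] <;> ring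

/-- The two ends of the arrow decide: a large square containing both has its centre at sup-distance
at most 1 from each, and parity leaves only these ends as possible centres. -/
theorem support_subset_largeSquare_iff (n : ℕ) (z g : ℤ × ℤ) (e : Fin 4) (c : Colour) :
    (arrowTile (centre (2 ^ n) z) e c).support ⊆ motion n g '' largeSquare ↔
      g = z ∨ g = neighbour z e := by
  constructor
  · intro h
    have h1 := h (tail_mem_support _ e c)
    have h2 := h (head_mem_support _ e c)
    rw [centre_add_diagonal] at h2
    rw [mem_image_motion_largeSquare] at h1 h2
    simp only [largeSquare, Set.mem_ofPred_eq, Fin.forall_fin_two, Set.mem_Icc, PiLp.sub_apply,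
      centre_zero, centre_one] at h1 h2
    have key : ∀ w : ℤ × ℤ,
        ((-1 ≤ (w.1 : ℝ) + w.2 + 1 - 2 ^ n - (g.1 + g.2 + 1 - 2 ^ n) ∧
          (w.1 : ℝ) + w.2 + 1 - 2 ^ n - (g.1 + g.2 + 1 - 2 ^ n) ≤ 1) ∧
         -1 ≤ (w.1 : ℝ) - w.2 - (g.1 - g.2) ∧ (w.1 : ℝ) - w.2 - (g.1 - g.2) ≤ 1) →
        (-1 ≤ w.1 + w.2 - (g.1 + g.2) ∧ w.1 + w.2 - (g.1 + g.2) ≤ 1) ∧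
         -1 ≤ w.1 - w.2 - (g.1 - g.2) ∧ w.1 - w.2 - (g.1 - g.2) ≤ 1 := by
      rintro w ⟨⟨h1, h2⟩, h3, h4⟩
      rify
      exact ⟨⟨by linarith, by linarith⟩, h3, h4⟩
    have h1 := key _ h1
    have h2 := key _ h2
    obtain ⟨i, j⟩ := z
    obtain ⟨i', j'⟩ := g
    fin_cases e <;> simp [neighbour] at h1 h2 ⊢ <;> omega
  · rintro hg v hv
    rw [mem_image_motion_largeSquare]
    simp only [arrowTile, centre_add_diagonal, Set.mem_ofPred_eq, Fin.forall_fin_two, centre_zero,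
      centre_one, Set.mem_uIcc] at hv
    simp only [largeSquare, Set.mem_ofPred_eq, Fin.forall_fin_two, Set.mem_Icc, PiLp.sub_apply,
      centre_zero, centre_one]
    rcases hg with h | h <;> rw [h] <;> clear h <;> fin_cases e <;> simp [neighbour] at hv ⊢ <;>
    rcases hv with ⟨h0 | h0, h1 | h1⟩ <;> refine ⟨⟨?_, ?_⟩, ?_, ?_⟩ <;>
    linarith [h0.1, h0.2, h1.1, h1.2]

theorem mem_visible_iff (n : ℕ) (τ : Tile) :
    τ ∈ visible n ↔ ∃ z e, InBox n 0 0 z ∧ (InBox n 0 0 (neighbour z e) → Wins z e) ∧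
      τ = arrowTile (centre (2 ^ n) z) e (colourOf (e - turns z)) := by
  have h1 : τ ∈ visible n ↔ ∃ f, OccursAfter (fun g => ¬ τ.support ⊆ g '' largeSquare) f (stack n) ∧
      ∃ c : Colour, τ = (prototile c).map f := by
    constructor
    · rintro ⟨above, f, below, h, hc, hg⟩
      exact ⟨f, ⟨above, below, h, hg⟩, hc⟩
    · rintro ⟨f, ⟨above, below, h, hg⟩, hc⟩
      exact ⟨above, f, below, h, hc, hg⟩
  rw [h1]
  simp only [stack_eq_map_motion, occursAfter_map]
  have h2 : ∀ z e c, OccursAfter (fun g => ¬ (arrowTile (centre (2 ^ n) z) e c).support ⊆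
      motion n g '' largeSquare) z (centreStack n) ↔
      InBox n 0 0 z ∧ (InBox n 0 0 (neighbour z e) → Wins z e) := by
    intro z e c
    simp only [support_subset_largeSquare_iff, not_or]
    exact (isBoxStack_centreStack n).2 z e
  constructor
  · rintro ⟨_, ⟨z, rfl, hz⟩, c, rfl⟩
    rw [prototile_map_motion] at hz ⊢
    refine ⟨z, colourIndex c + turns z, ((h2 _ _ _).1 hz).1, ((h2 _ _ _).1 hz).2, ?_⟩
    rw [add_sub_cancel_right, colourOf_colourIndex]
  · rintro ⟨z, e, h3, h4, rfl⟩
    refine ⟨_, ⟨z, rfl, (h2 _ _ _).2 ⟨h3, h4⟩⟩, colourOf (e - turns z), ?_⟩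
    rw [prototile_map_motion, colourIndex_colourOf, sub_add_cancel]

/-! ### The tiles of the arrowed tiling -/

/-- The tile of the large square with index `z` in direction `e`. -/
noncomputable def gridTile (z : ℤ × ℤ) (e : Fin 4) : Tile :=
  arrowTile (centre 0 z) e (colourOf (e - turns z))

theorem wins_add_two_pow (n : ℕ) {z : ℤ × ℤ} (h1 : |z.1| + 1 < 2 ^ n) (h2 : |z.2| + 1 < 2 ^ n)
    (e : Fin 4) : Wins (z.1 + 2 ^ (n + 1), z.2 + 2 ^ (n + 1)) e ↔ Wins z e := by
  have h1' : |z.1 + 1| < 2 ^ n := lt_of_le_of_lt (abs_add_le _ _) (by simpa using h1)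
  have h2' : |z.2 + 1| < 2 ^ n := lt_of_le_of_lt (abs_add_le _ _) (by simpa using h2)
  have h1'' : |z.1| < 2 ^ n := by linarith
  have h2'' : |z.2| < 2 ^ n := by linarith
  fin_cases e <;> simp only [Wins]
  · exact not_congr (topV_add_two_pow n h2'' h1'')
  · simpa [add_right_comm] using topU_add_two_pow n h1' h2''
  · simpa [add_right_comm] using topV_add_two_pow n h2' h1''
  · exact not_congr (topU_add_two_pow n h1'' h2'')

theorem turns_add_two_mul (z w : ℤ × ℤ) : turns (z.1 + 2 * w.1, z.2 + 2 * w.2) = turns z := by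
  simp [turns]

theorem exists_eq_gridTile_of_mem_visible {n : ℕ} {τ : Tile} (h : τ ∈ visible (n + 2)) :
    ∃ z e, τ = gridTile z e := by
  obtain ⟨z, e, -, -, rfl⟩ := (mem_visible_iff _ _).1 h
  -- The centre of the index square of side `2 ^ (n + 2)` is moved to the origin; the shift `2 ^ (n
  -- + 1)` is even, so `turns` does not change.
  refine ⟨(z.1 + 2 * (-2 ^ n), z.2 + 2 * (-2 ^ n)), e, ?_⟩
  rw [gridTile, turns_add_two_mul z (-2 ^ n, -2 ^ n)]
  congr 1
  apply plane_ext <;> simp [centre_zero, centre_one]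
  ring

theorem gridTile_mem_visible_iff {n : ℕ} {z : ℤ × ℤ} (h1 : |z.1| + 1 < 2 ^ n)
    (h2 : |z.2| + 1 < 2 ^ n) (e : Fin 4) : gridTile z e ∈ visible (n + 2) ↔ Wins z e := by
  have hz : gridTile z e = arrowTile (centre (2 ^ (n + 2)) (z.1 + 2 ^ (n + 1), z.2 + 2 ^ (n + 1))) e
      (colourOf (e - turns (z.1 + 2 ^ (n + 1), z.2 + 2 ^ (n + 1)))) := by
    have := turns_add_two_mul z (2 ^ n, 2 ^ n)
    simp only [← pow_succ'] at this
    rw [gridTile, this]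
    congr 1
    apply plane_ext <;> simp [centre_zero, centre_one]
    ring
  have hp : (2 : ℤ) ^ (n + 2) = 4 * 2 ^ n := by ring
  have hp' : (2 : ℤ) ^ (n + 1) = 2 * 2 ^ n := by ring
  have ha := abs_lt.1 (show |z.1| < 2 ^ n - 1 by linarith)
  have hb := abs_lt.1 (show |z.2| < 2 ^ n - 1 by linarith)
  rw [mem_visible_iff, ← wins_add_two_pow n h1 h2]
  constructor
  · rintro ⟨z', e', h3, h4, h5⟩
    rw [hz] at h5
    obtain ⟨h6, rfl, -⟩ := arrowTile_inj.1 h5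
    obtain rfl := centre_injective _ h6
    refine h4 ?_
    fin_cases e <;> simp [InBox, neighbour, hp, hp'] <;> omega
  · intro h
    refine ⟨_, e, ?_, fun _ => h, hz⟩
    simp only [InBox, hp, hp']
    omega

theorem eventually_lt_two_pow (a : ℤ) : ∀ᶠ n : ℕ in Filter.atTop, a < 2 ^ n :=
  (tendsto_pow_atTop_atTop_of_one_lt (by norm_num : (1 : ℤ) < 2)).eventually_gt_atTop a

theorem mem_arrowedTiling_iff (τ : Tile) :
    τ ∈ arrowedTiling ↔ ∃ z e, Wins z e ∧ τ = gridTile z e := by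
  have key : ∀ z e, gridTile z e ∈ arrowedTiling ↔ Wins z e := by
    intro z e
    have h : ∀ᶠ n : ℕ in Filter.atTop, gridTile z e ∈ visible (n + 2) ↔ Wins z e := by
      filter_upwards [eventually_lt_two_pow (|z.1| + 1), eventually_lt_two_pow (|z.2| + 1)]
        with n h1 h2
      exact gridTile_mem_visible_iff h1 h2 e
    have h' : gridTile z e ∈ arrowedTiling ↔
        ∀ᶠ n : ℕ in Filter.atTop, gridTile z e ∈ visible (n + 2) := by
      have := Filter.eventually_map (f := Filter.atTop) (m := fun n : ℕ => n + 2)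
        (P := fun n => gridTile z e ∈ visible n)
      rwa [Filter.map_add_atTop_eq_nat] at this
    rw [h', Filter.eventually_congr h, Filter.eventually_const]
  constructor
  · intro h
    obtain ⟨n, hn⟩ := Filter.eventually_atTop.1 h
    obtain ⟨z, e, rfl⟩ := exists_eq_gridTile_of_mem_visible (hn (n + 2) (by omega))
    exact ⟨z, e, (key z e).1 h, rfl⟩
  · rintro ⟨z, e, h, rfl⟩
    exact (key z e).2 h

/-! ### Vertex configurations recur -/

/-- The four comparisons at the vertices `(a, b)` and `(a', b')` agree. -/
def SameTops (a b a' b' : ℤ) : Prop :=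
  (topU a b ↔ topU a' b') ∧ (topU a (b - 1) ↔ topU a' (b' - 1)) ∧
  (topV a b ↔ topV a' b') ∧ (topV (a - 1) b ↔ topV (a' - 1) b')

theorem exists_sameTops_of_odd_right (a : ℤ) {b : ℤ} (hb : b % 2 = 1) :
    ∃ a₀ b₀ : ℤ, a₀ % 2 = a % 2 ∧ b₀ % 2 = b % 2 ∧
      ∀ x y : ℤ, SameTops a b (a₀ + 16 * x) (b₀ + 16 * y) := by
  rcases even_or_odd_of_int a with ⟨α, rfl⟩ | ha
  · rcases even_or_odd_of_int α with ⟨γ, rfl⟩ | hα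
    · have h1 : (b - 1) / 2 = b / 2 := by omega
      by_cases h : topU γ (b / 2 / 2)
      -- On the line `4 * (1 + 4 * x)` the rule is `oddRuleU` with first argument 1 modulo 4. It
      -- holds if the quarter of `b₀` is 0 modulo 4 and fails if it is 1, hence `b % 4` here and `b
      -- % 4 + 4` below.
      · refine ⟨4, b % 4, by omega, by omega, fun x y => ?_⟩
        have e : 4 + 16 * x = 2 * (2 * (1 + 4 * x)) := by ring
        rw [SameTops, e]
        simp only [topU_two_mul, h1, h, true_iff, topU_odd (show (1 + 4 * x) % 2 = 1 by omega), topV_odd hb,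
          topV_odd (show (b % 4 + 16 * y) % 2 = 1 by omega), oddRuleU, oddRuleV]
        omega
      · refine ⟨4, b % 4 + 4, by omega, by omega, fun x y => ?_⟩
        have e : 4 + 16 * x = 2 * (2 * (1 + 4 * x)) := by ring
        rw [SameTops, e]
        simp only [topU_two_mul, h1, h, false_iff, topU_odd (show (1 + 4 * x) % 2 = 1 by omega), topV_odd hb,
          topV_odd (show (b % 4 + 4 + 16 * y) % 2 = 1 by omega), oddRuleU, oddRuleV]
        omega
    · refine ⟨2 * α, b, rfl, rfl, fun x y => ?_⟩
      have e : 2 * α + 16 * x = 2 * (α + 8 * x) := by ring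
      rw [SameTops, e]
      simp only [topU_two_mul, topU_odd hα, topU_odd (show (α + 8 * x) % 2 = 1 by omega),
        topV_odd hb, topV_odd (show (b + 16 * y) % 2 = 1 by omega), oddRuleU, oddRuleV]
      omega
  · refine ⟨a, b, rfl, rfl, fun x y => ?_⟩
    simp only [SameTops, topU_odd ha, topU_odd (show (a + 16 * x) % 2 = 1 by omega),
      topV_odd hb, topV_odd (show (b + 16 * y) % 2 = 1 by omega), oddRuleU, oddRuleV]
    omega

theorem exists_sameTops_of_odd_left {a : ℤ} (ha : a % 2 = 1) (b : ℤ) :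
    ∃ a₀ b₀ : ℤ, a₀ % 2 = a % 2 ∧ b₀ % 2 = b % 2 ∧
      ∀ x y : ℤ, SameTops a b (a₀ + 16 * x) (b₀ + 16 * y) := by
  rcases even_or_odd_of_int b with ⟨β, rfl⟩ | hb
  · rcases even_or_odd_of_int β with ⟨γ, rfl⟩ | hβ
    · have h1 : (a - 1) / 2 = a / 2 := by omega
      by_cases h : topV (a / 2 / 2) γ
      · refine ⟨a % 4, 4, by omega, by omega, fun x y => ?_⟩
        have e : 4 + 16 * y = 2 * (2 * (1 + 4 * y)) := by ring
        rw [SameTops, e]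
        simp only [topV_two_mul, h1, h, true_iff, topV_odd (show (1 + 4 * y) % 2 = 1 by omega), topU_odd ha,
          topU_odd (show (a % 4 + 16 * x) % 2 = 1 by omega), oddRuleU, oddRuleV]
        omega
      -- `oddRuleV` with second argument 1 modulo 4 fails only for first argument 2 modulo 4, hence
      -- the summand 8.
      · refine ⟨a % 4 + 8, 4, by omega, by omega, fun x y => ?_⟩
        have e : 4 + 16 * y = 2 * (2 * (1 + 4 * y)) := by ring
        rw [SameTops, e]
        simp only [topV_two_mul, h1, h, false_iff, topV_odd (show (1 + 4 * y) % 2 = 1 by omega), topU_odd ha,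
          topU_odd (show (a % 4 + 8 + 16 * x) % 2 = 1 by omega), oddRuleU, oddRuleV]
        omega
    · refine ⟨a, 2 * β, rfl, rfl, fun x y => ?_⟩
      have e : 2 * β + 16 * y = 2 * (β + 8 * y) := by ring
      rw [SameTops, e]
      simp only [topV_two_mul, topV_odd hβ, topV_odd (show (β + 8 * y) % 2 = 1 by omega),
        topU_odd ha, topU_odd (show (a + 16 * x) % 2 = 1 by omega), oddRuleU, oddRuleV]
      omega
  · exact exists_sameTops_of_odd_right a hb

theorem sameTops_two_mul_left (a b a' b' : ℤ) :
    SameTops (2 * a) (2 * b) a' b' ↔ SameTops a b a' b' := by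
  have h1 : 2 * a / 2 = a := by omega
  have h2 : 2 * b / 2 = b := by omega
  have h3 : (2 * a - 1) / 2 = a - 1 := by omega
  have h4 : (2 * b - 1) / 2 = b - 1 := by omega
  simp only [SameTops, topU_two_mul, topV_two_mul, h1, h2, h3, h4]

theorem SameTops.symm {a b a' b' : ℤ} (h : SameTops a b a' b') : SameTops a' b' a b :=
  ⟨h.1.symm, h.2.1.symm, h.2.2.1.symm, h.2.2.2.symm⟩

/-- Descent by halving both coordinates ends at a vertex with an odd coordinate or at the origin. -/
theorem exists_sameTops (a b : ℤ) :
    ∃ a₀ b₀ : ℤ, ∀ x y : ℤ, SameTops a b (a₀ + 16 * x) (b₀ + 16 * y) := by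
  induction h : a.natAbs + b.natAbs using Nat.strong_induction_on generalizing a b with
  | _ n ih =>
    rcases even_or_odd_of_int a with ⟨α, rfl⟩ | ha
    · rcases even_or_odd_of_int b with ⟨β, rfl⟩ | hb
      · by_cases h0 : α = 0 ∧ β = 0
        · obtain ⟨rfl, rfl⟩ := h0
          -- The singular vertex at the origin has the same four comparisons as `(1, 1)`; its parity
          -- is lost here.
          refine ⟨1, 1, fun x y => ?_⟩
          simp only [SameTops, mul_zero, topU_zero, topV_zero, true_iff,
            topU_odd (show (1 + 16 * x) % 2 = 1 by omega),
            topV_odd (show (1 + 16 * y) % 2 = 1 by omega), oddRuleU, oddRuleV]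
          omega
        · obtain ⟨a₀, b₀, h1⟩ := ih (α.natAbs + β.natAbs) (by omega) α β rfl
          exact ⟨a₀, b₀, fun x y => (sameTops_two_mul_left _ _ _ _).2 (h1 x y)⟩
      · obtain ⟨a₀, b₀, -, -, h1⟩ := exists_sameTops_of_odd_right (2 * α) hb
        exact ⟨a₀, b₀, h1⟩
    · obtain ⟨a₀, b₀, -, -, h1⟩ := exists_sameTops_of_odd_left ha b
      exact ⟨a₀, b₀, h1⟩

/-- Parity matters because `2 ^ K * (a' - a)` must be a multiple of the period `2 ^ (K + 1)`. If
both coordinates are even, the representative of the halved vertex is doubled, which turns 16 into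
32. -/
theorem exists_sameTops_of_parity (a b : ℤ) :
    ∃ a₀ b₀ : ℤ, a₀ % 2 = a % 2 ∧ b₀ % 2 = b % 2 ∧
      ∀ x y : ℤ, SameTops a b (a₀ + 32 * x) (b₀ + 32 * y) := by
  have key : (∃ a₀ b₀ : ℤ, a₀ % 2 = a % 2 ∧ b₀ % 2 = b % 2 ∧
      ∀ x y : ℤ, SameTops a b (a₀ + 16 * x) (b₀ + 16 * y)) → ∃ a₀ b₀ : ℤ, a₀ % 2 = a % 2 ∧
      b₀ % 2 = b % 2 ∧ ∀ x y : ℤ, SameTops a b (a₀ + 32 * x) (b₀ + 32 * y) := by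
    rintro ⟨a₀, b₀, h1, h2, h3⟩
    refine ⟨a₀, b₀, h1, h2, fun x y => ?_⟩
    have := h3 (2 * x) (2 * y)
    rwa [← mul_assoc, ← mul_assoc] at this
  rcases even_or_odd_of_int a with ⟨α, rfl⟩ | ha
  · rcases even_or_odd_of_int b with ⟨β, rfl⟩ | hb
    · obtain ⟨a₀, b₀, h⟩ := exists_sameTops α β
      refine ⟨2 * a₀, 2 * b₀, by omega, by omega, fun x y => ?_⟩
      rw [show 2 * a₀ + 32 * x = 2 * (a₀ + 16 * x) by ring,
        show 2 * b₀ + 32 * y = 2 * (b₀ + 16 * y) by ring, sameTops_two_mul_left]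
      exact ((sameTops_two_mul_left _ _ _ _).2 (h x y).symm).symm
    · exact key (exists_sameTops_of_odd_right _ hb)
  · exact key (exists_sameTops_of_odd_left ha _)

theorem ediv_eq_or_eq {M w b : ℤ} (h : M * (b - 1) ≤ w) (h' : w < M * (b + 1)) :
    w / M = b - 1 ∨ w / M = b := by
  by_cases hb : w < M * b
  · exact Or.inl (ediv_eq_of_mul_le_of_lt h (by linarith))
  · exact Or.inr (ediv_eq_of_mul_le_of_lt (by linarith) (by linarith))

theorem exists_pow_succ_of_between {K : ℕ} {a p : ℤ} (h1 : 2 ^ K * (a - 1) < p)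
    (h2 : p < 2 ^ K * (a + 1)) (h : p ≠ 2 ^ K * a) : ∃ k, K = k + 1 ∧ ¬ (2 : ℤ) ^ (k + 1) ∣ p := by
  have hd : ¬ (2 : ℤ) ^ K ∣ p := by
    rcases lt_or_gt_of_ne h with h | h
    · exact not_two_pow_dvd_of_between h1 (by linarith)
    · exact not_two_pow_dvd_of_between h (by linarith)
  obtain _ | k := K
  · simp at hd
  · exact ⟨k, rfl, hd⟩

/-- Off the line `p = 2 ^ K * a` this is periodicity; on it, self-similarity reduces to a comparison
at the vertex `(a, b)`. -/
theorem topU_add_of_sameTops {K : ℕ} {a b a' b' x y p w : ℤ} (h : SameTops a b a' b')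
    (ha : a' = a + 2 * x) (hb : b' = b + 2 * y) (h1 : 2 ^ K * (a - 1) < p)
    (h2 : p < 2 ^ K * (a + 1)) (h3 : 2 ^ K * (b - 1) ≤ w) (h4 : w < 2 ^ K * (b + 1)) :
    topU (p + 2 ^ (K + 1) * x) (w + 2 ^ (K + 1) * y) ↔ topU p w := by
  by_cases hp : p = 2 ^ K * a
  · have e1 : p + 2 ^ (K + 1) * x = 2 ^ K * a' := by rw [hp, ha]; ring
    have e2 : (w + 2 ^ (K + 1) * y) / 2 ^ K = w / 2 ^ K + 2 * y := by
      rw [show (2 : ℤ) ^ (K + 1) * y = 2 ^ K * (2 * y) by ring,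
        Int.add_mul_ediv_left _ _ (by positivity)]
    rw [e1, hp, topU_two_pow_mul, topU_two_pow_mul, e2]
    rcases ediv_eq_or_eq h3 h4 with e | e
    · rw [e, show b - 1 + 2 * y = b' - 1 by rw [hb]; ring]
      exact h.2.1.symm
    · rw [e, ← hb]
      exact h.1.symm
  · obtain ⟨k, rfl, hk⟩ := exists_pow_succ_of_between h1 h2 hp
    exact topU_add_period k p w x y hk

theorem topV_add_of_sameTops {K : ℕ} {a b a' b' x y p w : ℤ} (h : SameTops a b a' b')
    (ha : a' = a + 2 * x) (hb : b' = b + 2 * y) (h1 : 2 ^ K * (b - 1) < p)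
    (h2 : p < 2 ^ K * (b + 1)) (h3 : 2 ^ K * (a - 1) ≤ w) (h4 : w < 2 ^ K * (a + 1)) :
    topV (w + 2 ^ (K + 1) * x) (p + 2 ^ (K + 1) * y) ↔ topV w p := by
  by_cases hp : p = 2 ^ K * b
  · have e1 : p + 2 ^ (K + 1) * y = 2 ^ K * b' := by rw [hp, hb]; ring
    have e2 : (w + 2 ^ (K + 1) * x) / 2 ^ K = w / 2 ^ K + 2 * x := by
      rw [show (2 : ℤ) ^ (K + 1) * x = 2 ^ K * (2 * x) by ring,
        Int.add_mul_ediv_left _ _ (by positivity)]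
    rw [e1, hp, topV_two_pow_mul, topV_two_pow_mul, e2]
    rcases ediv_eq_or_eq h3 h4 with e | e
    · rw [e, show a - 1 + 2 * x = a' - 1 by rw [ha]; ring]
      exact h.2.2.2.symm
    · rw [e, ← ha]
      exact h.2.2.1.symm
  · obtain ⟨k, rfl, hk⟩ := exists_pow_succ_of_between h1 h2 hp
    exact topV_add_period k w p x y hk

theorem wins_add_of_sameTops {K : ℕ} {a b a' b' x y : ℤ} {z : ℤ × ℤ} (h : SameTops a b a' b')
    (ha : a' = a + 2 * x) (hb : b' = b + 2 * y) (h1 : 2 ^ K * (a - 1) < z.1)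
    (h2 : z.1 + 1 < 2 ^ K * (a + 1)) (h3 : 2 ^ K * (b - 1) < z.2) (h4 : z.2 + 1 < 2 ^ K * (b + 1))
    (e : Fin 4) : Wins (z + (2 ^ (K + 1) * x, 2 ^ (K + 1) * y)) e ↔ Wins z e := by
  fin_cases e <;> simp only [Wins, Prod.fst_add, Prod.snd_add]
  · exact not_congr (topV_add_of_sameTops h ha hb (by linarith) (by linarith) (by linarith)
      (by linarith))
  · rw [add_right_comm]
    exact topU_add_of_sameTops h ha hb (by linarith) (by linarith) (by linarith) (by linarith)
  · rw [add_right_comm]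
    exact topV_add_of_sameTops h ha hb (by linarith) (by linarith) (by linarith) (by linarith)
  · exact not_congr (topU_add_of_sameTops h ha hb (by linarith) (by linarith) (by linarith)
      (by linarith))

/-! ### Linear repetitivity of the arrowed tiling -/

/-- The translation of the plane that belongs to a translation of the indices. -/
noncomputable def latticeVec (l : ℤ × ℤ) : Plane := !₂[(l.1 : ℝ) + l.2, l.1 - l.2]

theorem latticeVec_zero_apply (l : ℤ × ℤ) : latticeVec l 0 = l.1 + l.2 := rfl

theorem latticeVec_one_apply (l : ℤ × ℤ) : latticeVec l 1 = l.1 - l.2 := rfl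

theorem centre_add (t : ℝ) (z l : ℤ × ℤ) : centre t (z + l) = centre t z + latticeVec l := by
  apply plane_ext <;>
  simp [centre_zero, centre_one, latticeVec_zero_apply, latticeVec_one_apply] <;> ring

theorem gridTile_map_add (z l : ℤ × ℤ) (e : Fin 4) :
    (gridTile z e).map (fun v => v + latticeVec l) =
      arrowTile (centre 0 (z + l)) e (colourOf (e - turns z)) := by
  rw [gridTile, arrowTile_map_add, centre_add]

theorem abs_sub_apply_le_dist (v w : Plane) (k : Fin 2) : |v k - w k| ≤ dist v w := by
  rw [dist_eq_norm]
  exact PiLp.norm_apply_le (v - w) k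

theorem dist_le_abs_add_abs (v w : Plane) : dist v w ≤ |v 0 - w 0| + |v 1 - w 1| := by
  rw [EuclideanSpace.dist_eq, Fin.sum_univ_two, Real.dist_eq, Real.dist_eq]
  apply Real.sqrt_le_iff.2
  constructor
  · positivity
  · nlinarith [mul_nonneg (abs_nonneg (v 0 - w 0)) (abs_nonneg (v 1 - w 1))]

theorem dist_le_of_mem_support {p v : Plane} {e : Fin 4} {c : Colour}
    (h : v ∈ (arrowTile p e c).support) : dist v p ≤ 2 := by
  have h1 : ∀ k, |v k - p k| ≤ 1 := by
    intro k
    have h2 := Set.abs_sub_left_of_mem_uIcc (h k)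
    have h3 : |diagonal e k| = 1 := by fin_cases e <;> fin_cases k <;> simp [diagonal]
    simpa [h3] using h2
  exact (dist_le_abs_add_abs v p).trans (by linarith [h1 0, h1 1])

theorem index_bounds {z : ℤ × ℤ} {y : Plane} {r : ℝ} (h : dist (centre 0 z) y < r) :
    |(z.1 : ℝ) - (y 0 + y 1 - 1) / 2| < r ∧ |(z.2 : ℝ) - (y 0 - y 1 - 1) / 2| < r := by
  have h0 := abs_lt.1 ((abs_sub_apply_le_dist (centre 0 z) y 0).trans_lt h)
  have h1 := abs_lt.1 ((abs_sub_apply_le_dist (centre 0 z) y 1).trans_lt h)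
  rw [centre_zero] at h0
  rw [centre_one] at h1
  constructor <;> rw [abs_lt] <;> constructor <;> linarith [h0.1, h0.2, h1.1, h1.2]

theorem dist_centre_le (z : ℤ × ℤ) (x : Plane) : dist (centre 0 z) x ≤
    2 * |(z.1 : ℝ) - (x 0 + x 1 - 1) / 2| + 2 * |(z.2 : ℝ) - (x 0 - x 1 - 1) / 2| := by
  refine (dist_le_abs_add_abs _ _).trans ?_
  have h0 := abs_add_le ((z.1 : ℝ) - (x 0 + x 1 - 1) / 2) ((z.2 : ℝ) - (x 0 - x 1 - 1) / 2)
  have h1 := abs_sub ((z.1 : ℝ) - (x 0 + x 1 - 1) / 2) ((z.2 : ℝ) - (x 0 - x 1 - 1) / 2)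
  rw [centre_zero, centre_one]
  rw [show (z.1 : ℝ) + z.2 + 1 - 0 - x 0 =
    (z.1 : ℝ) - (x 0 + x 1 - 1) / 2 + ((z.2 : ℝ) - (x 0 - x 1 - 1) / 2) by ring,
    show (z.1 : ℝ) - z.2 - x 1 =
    (z.1 : ℝ) - (x 0 + x 1 - 1) / 2 - ((z.2 : ℝ) - (x 0 - x 1 - 1) / 2) by ring]
  linarith

/-- A vertex at scale `M` whose surroundings contain all integers close to `c`. -/
theorem exists_scale_vertex {M : ℤ} {r : ℝ} (hM : 2 * r + 4 < M) (hr : 0 < r) (c : ℝ) :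
    ∃ a : ℤ, ∀ i : ℤ, |(i : ℝ) - c| < r → M * (a - 1) < i ∧ i + 1 < M * (a + 1) := by
  have hM0 : 0 < M := by
    have : (0 : ℝ) < M := by linarith
    exact_mod_cast this
  refine ⟨(⌊c - r⌋ - 1) / M + 1, fun i hi => ?_⟩
  have h1 := Int.mul_ediv_self_le (x := ⌊c - r⌋ - 1) (k := M) hM0.ne'
  have h2 := Int.lt_mul_ediv_self_add (x := ⌊c - r⌋ - 1) hM0
  have h3 := Int.floor_le (c - r)
  have h4 := Int.lt_floor_add_one (c - r)
  obtain ⟨h5, h6⟩ := abs_lt.1 hi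
  generalize (⌊c - r⌋ - 1) / M = q at *
  generalize ⌊c - r⌋ = f at *
  have h2' : (f : ℝ) ≤ M * q + M := by
    have : f ≤ M * q + M := by omega
    exact_mod_cast this
  have h7 : (f : ℝ) < i + 1 := by linarith
  have h8 : f ≤ i := by
    have : f < i + 1 := by exact_mod_cast h7
    omega
  have h9 : (i : ℝ) + 1 < M * (q + 1 + 1) := by linarith
  refine ⟨?_, by exact_mod_cast h9⟩
  rw [add_sub_cancel_right]
  omega

/-- Every residue class modulo `32` contains a vertex at scale `M` close to `c`. -/
theorem exists_close_vertex {M : ℤ} (hM : 0 < M) (a₀ : ℤ) (c : ℝ) :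
    ∃ m : ℤ, ∀ i : ℤ, M * (a₀ + 32 * m - 1) < i → i < M * (a₀ + 32 * m + 1) →
      |(i : ℝ) - c| < 33 * M := by
  have hM' : (0 : ℝ) < M := by exact_mod_cast hM
  -- The representative lies between `f + 1` and `f + 32` with `f = ⌊c / M⌋`; one more `M` for the
  -- neighbouring square gives 33.
  refine ⟨(⌊c / M⌋ - a₀) / 32 + 1, fun i h1 h2 => ?_⟩
  have h3 := (le_div_iff₀ hM').1 (Int.floor_le (c / M))
  have h4 := (div_lt_iff₀ hM').1 (Int.lt_floor_add_one (c / M))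
  generalize ⌊c / M⌋ = f at *
  have h5 : f + 1 ≤ a₀ + 32 * ((f - a₀) / 32 + 1) := by omega
  have h6 : a₀ + 32 * ((f - a₀) / 32 + 1) ≤ f + 32 := by omega
  generalize a₀ + 32 * ((f - a₀) / 32 + 1) = a' at *
  have h7 : M * f < i := lt_of_le_of_lt (mul_le_mul_of_nonneg_left (by omega) hM.le) h1
  have h8 : i < M * (f + 33) :=
    lt_of_lt_of_le h2 (mul_le_mul_of_nonneg_left (by omega) hM.le)
  have h7' : (M : ℝ) * f < i := by exact_mod_cast h7
  have h8' : (i : ℝ) < M * (f + 33) := by exact_mod_cast h8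
  rw [abs_lt]
  constructor <;> linarith

theorem exists_translate_ballPatch_subset {r s : ℝ} (hr : 0 < r) (hs : s < r) (y x : Plane) :
    ∃ l : ℤ × ℤ, translate (ballPatch arrowedTiling y s) (latticeVec l) ⊆
      ballPatch arrowedTiling x (1100 * (r + 1)) := by
  obtain ⟨k, hk1, hk2⟩ := exists_nat_pow_near (show 1 ≤ 2 * r + 4 by linarith)
    (show (1 : ℝ) < 2 by norm_num)
  set K := k + 1 with hK
  have hM : 2 * r + 4 < ((2 ^ K : ℤ) : ℝ) := by exact_mod_cast hk2
  have hM' : ((2 ^ K : ℤ) : ℝ) ≤ 4 * r + 8 := by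
    push_cast
    rw [hK, pow_succ]
    linarith
  have hM0 : (0 : ℤ) < 2 ^ K := by positivity
  obtain ⟨a, ha⟩ := exists_scale_vertex hM hr ((y 0 + y 1 - 1) / 2)
  obtain ⟨b, hb⟩ := exists_scale_vertex hM hr ((y 0 - y 1 - 1) / 2)
  obtain ⟨a₀, b₀, ha₀, hb₀, hab⟩ := exists_sameTops_of_parity a b
  obtain ⟨m, hm⟩ := exists_close_vertex hM0 a₀ ((x 0 + x 1 - 1) / 2)
  obtain ⟨n, hn⟩ := exists_close_vertex hM0 b₀ ((x 0 - x 1 - 1) / 2)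
  obtain ⟨u, hu⟩ : ∃ u, a₀ + 32 * m = a + 2 * u := ⟨(a₀ + 32 * m - a) / 2, by omega⟩
  obtain ⟨v, hv⟩ : ∃ v, b₀ + 32 * n = b + 2 * v := ⟨(b₀ + 32 * n - b) / 2, by omega⟩
  have hT := hab m n
  rw [hu] at hT hm
  rw [hv] at hT hn
  refine ⟨(2 ^ (K + 1) * u, 2 ^ (K + 1) * v), ?_⟩
  rintro _ ⟨τ, ⟨hτ, hτs⟩, rfl⟩
  obtain ⟨z, e, hz, rfl⟩ := (mem_arrowedTiling_iff _).1 hτ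
  have hd : dist (centre 0 z) y < r := lt_trans (hτs (tail_mem_support _ _ _)) hs
  obtain ⟨hz1, hz2⟩ := index_bounds hd
  obtain ⟨h1, h2⟩ := ha _ hz1
  obtain ⟨h3, h4⟩ := hb _ hz2
  have hturn : turns (z + (2 ^ (K + 1) * u, 2 ^ (K + 1) * v)) = turns z := by
    rw [← turns_add_two_mul z (2 ^ K * u, 2 ^ K * v)]
    congr 1
    ext <;> simp <;> ring
  have hgrid : Tile.map (fun w => w + latticeVec (2 ^ (K + 1) * u, 2 ^ (K + 1) * v)) (gridTile z e) =
      gridTile (z + (2 ^ (K + 1) * u, 2 ^ (K + 1) * v)) e := by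
    rw [gridTile_map_add, gridTile, hturn]
  rw [hgrid]
  refine ⟨(mem_arrowedTiling_iff _).2 ⟨_, e, (wins_add_of_sameTops hT rfl rfl h1 h2 h3 h4 e).2 hz,
    rfl⟩, fun w hw => ?_⟩
  have hw' := dist_le_of_mem_support hw
  have h5 := hm (z + (2 ^ (K + 1) * u, 2 ^ (K + 1) * v)).1
    (by simp only [Prod.fst_add, pow_succ]; linarith)
    (by simp only [Prod.fst_add, pow_succ]; linarith)
  have h6 := hn (z + (2 ^ (K + 1) * u, 2 ^ (K + 1) * v)).2
    (by simp only [Prod.snd_add, pow_succ]; linarith)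
    (by simp only [Prod.snd_add, pow_succ]; linarith)
  have h7 := dist_centre_le (z + (2 ^ (K + 1) * u, 2 ^ (K + 1) * v)) x
  have h8 := dist_triangle w (centre 0 (z + (2 ^ (K + 1) * u, 2 ^ (K + 1) * v))) x
  -- Both index errors are below `33 * 2 ^ K`, so the distance is below `132 * 2 ^ K + 2 ≤ 528 * r +
  -- 1058`.
  rw [Metric.mem_ball]
  linarith

/-! ### Counting integer points in discs -/

/-- The point of the plane with the given integer coordinates. -/
noncomputable def intPoint (z : ℤ × ℤ) : Plane := !₂[(z.1 : ℝ), z.2]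

/-- The half-open unit square with lower left vertex `intPoint z`. -/
def unitCell (z : ℤ × ℤ) : Set Plane :=
  WithLp.ofLp ⁻¹' Set.univ.pi fun k => Set.Ico (intPoint z k) (intPoint z k + 1)

theorem mem_unitCell_iff {z : ℤ × ℤ} {v : Plane} : v ∈ unitCell z ↔ z = (⌊v 0⌋, ⌊v 1⌋) := by
  simp only [unitCell, Set.mem_preimage, Set.mem_univ_pi, Fin.forall_fin_two, Set.mem_Ico,
    Prod.ext_iff, eq_comm (a := z.1), eq_comm (a := z.2), Int.floor_eq_iff]
  rfl

theorem volume_unitCell (z : ℤ × ℤ) : MeasureTheory.volume (unitCell z) = 1 := by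
  rw [unitCell, (PiLp.volume_preserving_ofLp (Fin 2)).measure_preimage
    (MeasurableSet.univ_pi fun _ => measurableSet_Ico).nullMeasurableSet, Real.volume_pi_Ico]
  simp

theorem measurableSet_unitCell (z : ℤ × ℤ) : MeasurableSet (unitCell z) :=
  (PiLp.volume_preserving_ofLp (Fin 2)).measurable
    (MeasurableSet.univ_pi fun _ => measurableSet_Ico)

theorem dist_intPoint_le {z : ℤ × ℤ} {v : Plane} (h : v ∈ unitCell z) :
    dist v (intPoint z) ≤ 2 := by
  rw [mem_unitCell_iff] at h
  subst h
  refine (dist_le_abs_add_abs _ _).trans ?_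
  have h0 : |v 0 - ⌊v 0⌋| ≤ 1 := by
    rw [abs_le]
    constructor <;> linarith [Int.floor_le (v 0), Int.lt_floor_add_one (v 0)]
  have h1 : |v 1 - ⌊v 1⌋| ≤ 1 := by
    rw [abs_le]
    constructor <;> linarith [Int.floor_le (v 1), Int.lt_floor_add_one (v 1)]
  exact (add_le_add h0 h1).trans (by norm_num)

theorem finite_setOf_abs_sub_lt (c d R : ℝ) :
    {z : ℤ × ℤ | |(z.1 : ℝ) - c| < R ∧ |(z.2 : ℝ) - d| < R}.Finite := by
  refine ((Set.finite_Icc ⌊c - R⌋ ⌈c + R⌉).prod (Set.finite_Icc ⌊d - R⌋ ⌈d + R⌉)).subset ?_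
  rintro z ⟨h1, h2⟩
  rw [abs_lt] at h1 h2
  refine ⟨⟨?_, ?_⟩, ?_, ?_⟩
  · exact_mod_cast (Int.floor_le (c - R)).trans (by linarith : c - R ≤ z.1)
  · exact_mod_cast (by linarith : (z.1 : ℝ) ≤ c + R).trans (Int.le_ceil (c + R))
  · exact_mod_cast (Int.floor_le (d - R)).trans (by linarith : d - R ≤ z.2)
  · exact_mod_cast (by linarith : (z.2 : ℝ) ≤ d + R).trans (Int.le_ceil (d + R))

theorem finite_setOf_dist_intPoint_lt (y : Plane) (R : ℝ) :
    {z : ℤ × ℤ | dist (intPoint z) y < R}.Finite := by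
  refine (finite_setOf_abs_sub_lt (y 0) (y 1) R).subset fun z hz => ⟨?_, ?_⟩
  · exact (abs_sub_apply_le_dist (intPoint z) y 0).trans_lt hz
  · exact (abs_sub_apply_le_dist (intPoint z) y 1).trans_lt hz

theorem volume_biUnion_unitCell {S : Set (ℤ × ℤ)} (hS : S.Finite) :
    MeasureTheory.volume (⋃ z ∈ S, unitCell z) = (S.ncard : ENNReal) := by
  have h : (⋃ z ∈ S, unitCell z) = ⋃ z ∈ hS.toFinset, unitCell z := by simp
  rw [h, MeasureTheory.measure_biUnion_finset]
  · simp [volume_unitCell, Set.ncard_eq_toFinset_card S hS]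
  · intro z _ z' _ hne
    refine Set.disjoint_left.2 fun v hv hv' => hne ?_
    rw [mem_unitCell_iff.1 hv, mem_unitCell_iff.1 hv']
  · exact fun z _ => measurableSet_unitCell z

theorem volume_ball_eq_ofReal (y : Plane) {R : ℝ} (hR : 0 ≤ R) :
    MeasureTheory.volume (Metric.ball y R) = ENNReal.ofReal (Real.pi * R ^ 2) := by
  rw [EuclideanSpace.volume_ball_fin_two, ← ENNReal.ofReal_pow hR, mul_comm,
    ← ENNReal.ofReal_mul Real.pi_pos.le]

theorem ncard_intPoint_le (y : Plane) {R : ℝ} (hR : 0 ≤ R) :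
    ({z : ℤ × ℤ | dist (intPoint z) y < R}.ncard : ℝ) ≤ Real.pi * (R + 2) ^ 2 := by
  have h : (⋃ z ∈ {z : ℤ × ℤ | dist (intPoint z) y < R}, unitCell z) ⊆ Metric.ball y (R + 2) := by
    intro v hv
    simp only [Set.mem_iUnion, exists_prop] at hv
    obtain ⟨z, hz, hv⟩ := hv
    have := dist_triangle v (intPoint z) y
    have h2 := dist_intPoint_le hv
    have hz' : dist (intPoint z) y < R := hz
    rw [Metric.mem_ball]
    linarith
  have h1 := MeasureTheory.measure_mono (μ := MeasureTheory.volume) h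
  rw [volume_biUnion_unitCell (finite_setOf_dist_intPoint_lt y R),
    volume_ball_eq_ofReal y (by linarith), ← ENNReal.ofReal_natCast] at h1
  exact (ENNReal.ofReal_le_ofReal_iff (by positivity)).1 h1

theorem le_ncard_intPoint (y : Plane) {R : ℝ} (hR : 2 ≤ R) :
    Real.pi * (R - 2) ^ 2 ≤ ({z : ℤ × ℤ | dist (intPoint z) y < R}.ncard : ℝ) := by
  have h : Metric.ball y (R - 2) ⊆ ⋃ z ∈ {z : ℤ × ℤ | dist (intPoint z) y < R}, unitCell z := by
    intro v hv
    have hm : v ∈ unitCell (⌊v 0⌋, ⌊v 1⌋) := mem_unitCell_iff.2 rfl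
    simp only [Set.mem_iUnion, exists_prop]
    refine ⟨_, ?_, hm⟩
    have := dist_triangle_left (intPoint (⌊v 0⌋, ⌊v 1⌋)) y v
    have h2 := dist_intPoint_le hm
    have hv' : dist v y < R - 2 := hv
    change dist (intPoint (⌊v 0⌋, ⌊v 1⌋)) y < R
    linarith
  have h1 := MeasureTheory.measure_mono (μ := MeasureTheory.volume) h
  rw [volume_biUnion_unitCell (finite_setOf_dist_intPoint_lt y R),
    volume_ball_eq_ofReal y (by linarith), ← ENNReal.ofReal_natCast] at h1
  exact (ENNReal.ofReal_le_ofReal_iff (by positivity)).1 h1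

/-! ### Uniform densities of sets of lattice points -/

/-- `Φ l x r` says, up to an error of `D` in the radius, that the lattice vector of `l` lies in the
disc of radius `r` about `x`. -/
def IsWindow (Φ : ℤ × ℤ → Plane → ℝ → Prop) (D : ℝ) : Prop :=
  ∀ l x r, (dist (latticeVec l) x < r - D → Φ l x r) ∧ (Φ l x r → dist (latticeVec l) x < r + D)

/-- The function `F` of a disc is uniformly asymptotic to `d` times the area of the disc. -/
def HasUniformDensity (F : Plane → ℝ → ℝ) (d : ℝ) : Prop :=
  TendstoUniformly (fun (r : ℝ) (x : Plane) => F x r / (Real.pi * r ^ 2)) (fun _ => d) Filter.atTop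

/-- The number of lattice points of `E` in the window. -/
noncomputable def windowCount (Φ : ℤ × ℤ → Plane → ℝ → Prop) (E : Set (ℤ × ℤ)) (x : Plane) (r : ℝ) :
    ℝ :=
  ({l ∈ E | Φ l x r}.ncard : ℝ)

theorem hasUniformDensity_iff {F : Plane → ℝ → ℝ} {d : ℝ} : HasUniformDensity F d ↔
    ∀ ε > 0, ∀ᶠ r in Filter.atTop, ∀ x, |F x r / (Real.pi * r ^ 2) - d| < ε := by
  simp only [HasUniformDensity, Metric.tendstoUniformly_iff, Real.dist_eq, abs_sub_comm]

theorem HasUniformDensity.sum {ι : Type*} (s : Finset ι) {F : ι → Plane → ℝ → ℝ} {d : ι → ℝ}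
    (h : ∀ i ∈ s, HasUniformDensity (F i) (d i)) :
    HasUniformDensity (fun x r => ∑ i ∈ s, F i x r) (∑ i ∈ s, d i) := by
  classical
  induction s using Finset.induction_on with
  | empty =>
    rw [hasUniformDensity_iff]
    intro ε hε
    exact Filter.Eventually.of_forall fun _ _ => by simpa using hε
  | insert i s hi ih =>
    have h1 := h i (Finset.mem_insert_self i s)
    have h2 := ih fun j hj => h j (Finset.mem_insert_of_mem hj)
    have h3 := TendstoUniformly.add h1 h2
    rw [HasUniformDensity, Finset.sum_insert hi]
    convert h3 using 1
    · funext r x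
      simp [Finset.sum_insert hi, add_div]
    · rfl

theorem tendsto_add_sq_div_sq (a : ℝ) :
    Filter.Tendsto (fun r : ℝ => (r + a) ^ 2 / r ^ 2) Filter.atTop (nhds 1) := by
  have h1 : Filter.Tendsto (fun r : ℝ => (1 + a / r) ^ 2) Filter.atTop (nhds ((1 + 0) ^ 2)) :=
    (tendsto_const_nhds.add (tendsto_const_nhds.div_atTop Filter.tendsto_id)).pow 2
  rw [add_zero, one_pow] at h1
  refine h1.congr' ?_
  filter_upwards [Filter.eventually_gt_atTop 0] with r hr
  field_simp

theorem hasUniformDensity_of_bounds {F : Plane → ℝ → ℝ} {d D : ℝ}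
    (h : ∀ r ≥ D, ∀ x, d * (Real.pi * (r - D) ^ 2) ≤ F x r ∧ F x r ≤ d * (Real.pi * (r + D) ^ 2)) :
    HasUniformDensity F d := by
  rw [hasUniformDensity_iff]
  intro ε hε
  have h1 := (tendsto_add_sq_div_sq D).const_mul d
  have h2 := (tendsto_add_sq_div_sq (-D)).const_mul d
  rw [mul_one] at h1 h2
  have h1' := (Metric.tendsto_nhds.1 h1) ε hε
  have h2' := (Metric.tendsto_nhds.1 h2) ε hε
  filter_upwards [h1', h2', Filter.eventually_gt_atTop 0, Filter.eventually_ge_atTop D]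
    with r h3 h4 hr hD x
  obtain ⟨h5, h6⟩ := h r hD x
  have hpos : 0 < Real.pi * r ^ 2 := by positivity
  have h7 : F x r / (Real.pi * r ^ 2) ≤ d * ((r + D) ^ 2 / r ^ 2) := by
    rw [div_le_iff₀ hpos]
    refine h6.trans (le_of_eq ?_)
    field_simp
  have h8 : d * ((r + -D) ^ 2 / r ^ 2) ≤ F x r / (Real.pi * r ^ 2) := by
    rw [le_div_iff₀ hpos]
    refine le_trans (le_of_eq ?_) h5
    field_simp
    ring
  rw [Real.dist_eq, abs_lt] at h3 h4
  rw [abs_lt]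
  constructor <;> linarith [h3.1, h3.2, h4.1, h4.2]

theorem dist_sq_plane (v w : Plane) : dist v w ^ 2 = (v 0 - w 0) ^ 2 + (v 1 - w 1) ^ 2 := by
  rw [EuclideanSpace.dist_eq, Fin.sum_univ_two, Real.dist_eq, Real.dist_eq, sq_abs, sq_abs,
    Real.sq_sqrt (by positivity)]

/-- The point with index `m` of the residue class of `ρ` modulo `N`. -/
def cosetPoint (N : ℕ) (ρ m : ℤ × ℤ) : ℤ × ℤ := (ρ.1 + N * m.1, ρ.2 + N * m.2)

theorem cosetPoint_injective {N : ℕ} (hN : 0 < N) (ρ : ℤ × ℤ) :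
    Function.Injective (cosetPoint N ρ) := by
  intro m m' h
  have hN' : (N : ℤ) ≠ 0 := by exact_mod_cast hN.ne'
  simp only [cosetPoint, Prod.mk.injEq, add_right_inj, mul_eq_mul_left_iff, hN', or_false] at h
  exact Prod.ext h.1 h.2

/-- `latticeVec` is `√2` times an orthogonal map, so counting coset points in a disc is counting
integer points in a rescaled disc. -/
theorem dist_latticeVec_cosetPoint {N : ℕ} (hN : 0 < N) (ρ m : ℤ × ℤ) (x : Plane) :
    dist (latticeVec (cosetPoint N ρ m)) x = √2 * N * dist (intPoint m)
      !₂[((x 0 + x 1) / 2 - ρ.1) / N, ((x 0 - x 1) / 2 - ρ.2) / N] := by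
  have hN' : (N : ℝ) ≠ 0 := by exact_mod_cast hN.ne'
  rw [← sq_eq_sq₀ dist_nonneg (by positivity), mul_pow, mul_pow, Real.sq_sqrt (by norm_num),
    dist_sq_plane, dist_sq_plane]
  simp only [latticeVec_zero_apply, latticeVec_one_apply, intPoint, cosetPoint,
    PiLp.toLp_apply, Matrix.cons_val_zero, Matrix.cons_val_one]
  push_cast
  field_simp
  ring

theorem IsWindow.finite {Φ : ℤ × ℤ → Plane → ℝ → Prop} {D : ℝ} (hΦ : IsWindow Φ D) (x : Plane)
    (r : ℝ) : {l | Φ l x r}.Finite := by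
  refine (finite_setOf_dist_intPoint_lt
    !₂[((x 0 + x 1) / 2 - 0) / 1, ((x 0 - x 1) / 2 - 0) / 1] ((r + D) / √2)).subset fun l hl => ?_
  have h := dist_latticeVec_cosetPoint one_pos 0 l x
  have hl' : dist (latticeVec l) x < r + D := (hΦ l x r).2 hl
  have e : cosetPoint 1 0 l = l := by simp [cosetPoint]
  rw [e] at h
  rw [Set.mem_ofPred_eq, lt_div_iff₀ (by positivity)]
  simp only [Prod.fst_zero, Prod.snd_zero, Nat.cast_one, mul_one, Int.cast_zero] at h
  linarith

theorem hasUniformDensity_coset {Φ : ℤ × ℤ → Plane → ℝ → Prop} {D : ℝ} (hΦ : IsWindow Φ D)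
    {N : ℕ} (hN : 0 < N) (ρ : ℤ × ℤ) :
    HasUniformDensity (fun x r => ({m | Φ (cosetPoint N ρ m) x r}.ncard : ℝ))
      (1 / (2 * (N : ℝ) ^ 2)) := by
  have hN' : (0 : ℝ) < N := by exact_mod_cast hN
  have h2 : (0 : ℝ) < √2 * N := by positivity
  have hsq : (√2 * N) ^ 2 = 2 * (N : ℝ) ^ 2 := by rw [mul_pow, Real.sq_sqrt (by norm_num)]
  -- The window contributes `|D|` to the radius error, the unit cells contribute 2 before rescaling
  -- by `√2 * N`.
  refine hasUniformDensity_of_bounds (D := |D| + 2 * (√2 * N)) fun r hr x => ?_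
  have hD1 := le_abs_self D
  have hD2 := neg_abs_le D
  have hD3 := abs_nonneg D
  set y : Plane := !₂[((x 0 + x 1) / 2 - ρ.1) / N, ((x 0 - x 1) / 2 - ρ.2) / N] with hy
  have hdist : ∀ m, dist (latticeVec (cosetPoint N ρ m)) x = √2 * N * dist (intPoint m) y :=
    fun m => dist_latticeVec_cosetPoint hN ρ m x
  have hsub1 : {m | dist (intPoint m) y < (r - |D|) / (√2 * N)} ⊆ {m | Φ (cosetPoint N ρ m) x r} := by
    intro m hm
    refine (hΦ _ x r).1 ?_
    rw [Set.mem_ofPred_eq, lt_div_iff₀ h2] at hm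
    rw [hdist]
    linarith
  have hsub2 : {m | Φ (cosetPoint N ρ m) x r} ⊆ {m | dist (intPoint m) y < (r + |D|) / (√2 * N)} := by
    intro m hm
    have := (hΦ _ x r).2 hm
    rw [hdist] at this
    rw [Set.mem_ofPred_eq, lt_div_iff₀ h2]
    linarith
  have hfin := finite_setOf_dist_intPoint_lt y ((r + |D|) / (√2 * N))
  have hc1 : ({m | dist (intPoint m) y < (r - |D|) / (√2 * N)}.ncard : ℝ) ≤
      ({m | Φ (cosetPoint N ρ m) x r}.ncard : ℝ) := by
    exact_mod_cast Set.ncard_le_ncard hsub1 (hfin.subset hsub2)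
  have hc2 : ({m | Φ (cosetPoint N ρ m) x r}.ncard : ℝ) ≤
      ({m | dist (intPoint m) y < (r + |D|) / (√2 * N)}.ncard : ℝ) := by
    exact_mod_cast Set.ncard_le_ncard hsub2 hfin
  constructor
  · refine le_trans (le_of_eq ?_) ((le_ncard_intPoint y ?_).trans hc1)
    · rw [← hsq]
      field_simp
      ring
    · rw [le_div_iff₀ h2]
      linarith
  · refine (hc2.trans (ncard_intPoint_le y ?_)).trans (le_of_eq ?_)
    · apply div_nonneg _ h2.le
      linarith
    · rw [← hsq]
      field_simp
      ring

theorem ncard_eq_sum_ncard_fiber {α β : Type*} {s : Set α} (hs : s.Finite) (f : α → β)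
    (t : Finset β) (h : ∀ a ∈ s, f a ∈ t) : s.ncard = ∑ b ∈ t, {a ∈ s | f a = b}.ncard := by
  classical
  rw [Set.ncard_eq_toFinset_card s hs,
    Finset.card_eq_sum_card_fiberwise (f := f) (t := t) (fun a ha => h a (by simpa using ha))]
  refine Finset.sum_congr rfl fun b _ => ?_
  rw [← Set.ncard_coe_finset]
  congr 1
  ext a
  simp

/-- The set is invariant under translations by multiples of `N`. -/
def IsPeriodic (N : ℕ) (L : Set (ℤ × ℤ)) : Prop := ∀ l m, cosetPoint N l m ∈ L ↔ l ∈ L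

/-- The representatives in `[0, N)²` of the residue classes in a set. -/
noncomputable def residues (N : ℕ) (L : Set (ℤ × ℤ)) : Finset (ℤ × ℤ) := by
  classical
  exact {ρ ∈ Finset.Ico 0 (N : ℤ) ×ˢ Finset.Ico 0 (N : ℤ) | ρ ∈ L}

theorem mem_residues {N : ℕ} {L : Set (ℤ × ℤ)} {ρ : ℤ × ℤ} : ρ ∈ residues N L ↔
    ((0 ≤ ρ.1 ∧ ρ.1 < N) ∧ 0 ≤ ρ.2 ∧ ρ.2 < N) ∧ ρ ∈ L := by
  simp [residues]

theorem cosetPoint_emod_ediv (N : ℕ) (l : ℤ × ℤ) :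
    cosetPoint N (l.1 % N, l.2 % N) (l.1 / N, l.2 / N) = l := by
  simp [cosetPoint, Int.emod_add_mul_ediv]

theorem IsPeriodic.emod_mem_iff {N : ℕ} {L : Set (ℤ × ℤ)} (h : IsPeriodic N L) (l : ℤ × ℤ) :
    (l.1 % (N : ℤ), l.2 % (N : ℤ)) ∈ L ↔ l ∈ L := by
  rw [← h _ (l.1 / N, l.2 / N), cosetPoint_emod_ediv]

theorem IsPeriodic.windowCount_eq {Φ : ℤ × ℤ → Plane → ℝ → Prop} {D : ℝ} (hΦ : IsWindow Φ D)
    {N : ℕ} (hN : 0 < N) {L : Set (ℤ × ℤ)} (hL : IsPeriodic N L) (x : Plane) (r : ℝ) :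
    windowCount Φ L x r =
      ∑ ρ ∈ residues N L, ({m | Φ (cosetPoint N ρ m) x r}.ncard : ℝ) := by
  have hN' : (0 : ℤ) < N := by exact_mod_cast hN
  rw [windowCount, ncard_eq_sum_ncard_fiber ((hΦ.finite x r).subset fun l hl => hl.2)
    (fun l => (l.1 % (N : ℤ), l.2 % (N : ℤ))) (residues N L)]
  · push_cast
    refine Finset.sum_congr rfl fun ρ hρ => ?_
    rw [mem_residues] at hρ
    rw [← Set.ncard_image_of_injective {m | Φ (cosetPoint N ρ m) x r} (cosetPoint_injective hN ρ)]
    congr 2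
    ext l
    constructor
    · rintro ⟨⟨h1, h2⟩, rfl⟩
      refine ⟨(l.1 / N, l.2 / N), ?_, cosetPoint_emod_ediv N l⟩
      rw [Set.mem_ofPred_eq, cosetPoint_emod_ediv]
      exact h2
    · rintro ⟨m, hm, rfl⟩
      refine ⟨⟨(hL _ _).2 hρ.2, hm⟩, ?_⟩
      ext
      · simp [cosetPoint, Int.emod_eq_of_lt hρ.1.1.1 hρ.1.1.2]
      · simp [cosetPoint, Int.emod_eq_of_lt hρ.1.2.1 hρ.1.2.2]
  · rintro l ⟨hl, -⟩
    exact mem_residues.2 ⟨⟨⟨Int.emod_nonneg _ hN'.ne', Int.emod_lt_of_pos _ hN'⟩,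
      Int.emod_nonneg _ hN'.ne', Int.emod_lt_of_pos _ hN'⟩, (hL.emod_mem_iff l).2 hl⟩

theorem IsPeriodic.hasUniformDensity {Φ : ℤ × ℤ → Plane → ℝ → Prop} {D : ℝ} (hΦ : IsWindow Φ D)
    {N : ℕ} (hN : 0 < N) {L : Set (ℤ × ℤ)} (hL : IsPeriodic N L) :
    HasUniformDensity (windowCount Φ L) ((residues N L).card * (1 / (2 * (N : ℝ) ^ 2))) := by
  have h := HasUniformDensity.sum (residues N L) fun ρ _ => hasUniformDensity_coset hΦ hN ρ
  rw [Finset.sum_const, nsmul_eq_mul] at h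
  have e : windowCount Φ L =
      fun x r => ∑ ρ ∈ residues N L, ({m | Φ (cosetPoint N ρ m) x r}.ncard : ℝ) :=
    funext fun x => funext fun r => hL.windowCount_eq hΦ hN x r
  rwa [e]

/-! ### Limit periodic sets -/

/-- Outside the lines on which one of the coordinates is congruent modulo `2 ^ k` to one of finitely
many numbers, the set is periodic; and this for each `k`. -/
def IsLimitPeriodic (E : Set (ℤ × ℤ)) : Prop :=
  ∃ F : Finset ℤ, ∀ k : ℕ, ∃ N : ℕ, 0 < N ∧ ∃ L, IsPeriodic N L ∧
    ∀ l : ℤ × ℤ, (∀ c ∈ F, ¬ (2 : ℤ) ^ k ∣ l.1 + c ∧ ¬ (2 : ℤ) ^ k ∣ l.2 + c) → (l ∈ E ↔ l ∈ L)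

theorem IsPeriodic.mul_left {N : ℕ} {L : Set (ℤ × ℤ)} (h : IsPeriodic N L) (M : ℕ) :
    IsPeriodic (M * N) L := by
  intro l m
  rw [← h l (M * m.1, M * m.2)]
  simp only [cosetPoint]
  push_cast
  rw [mul_comm (M : ℤ), mul_assoc, mul_assoc]

theorem IsPeriodic.inter {N : ℕ} {L L' : Set (ℤ × ℤ)} (h : IsPeriodic N L)
    (h' : IsPeriodic N L') : IsPeriodic N (L ∩ L') :=
  fun l m => and_congr (h l m) (h' l m)

theorem IsPeriodic.compl {N : ℕ} {L : Set (ℤ × ℤ)} (h : IsPeriodic N L) : IsPeriodic N Lᶜ :=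
  fun l m => not_congr (h l m)

theorem IsPeriodic.isLimitPeriodic {N : ℕ} (hN : 0 < N) {L : Set (ℤ × ℤ)} (h : IsPeriodic N L) :
    IsLimitPeriodic L :=
  ⟨∅, fun _ => ⟨N, hN, L, h, fun _ _ => Iff.rfl⟩⟩

theorem IsLimitPeriodic.inter {E E' : Set (ℤ × ℤ)} (h : IsLimitPeriodic E)
    (h' : IsLimitPeriodic E') : IsLimitPeriodic (E ∩ E') := by
  classical
  obtain ⟨F, hF⟩ := h
  obtain ⟨F', hF'⟩ := h'
  refine ⟨F ∪ F', fun k => ?_⟩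
  obtain ⟨N, hN, L, hL, h⟩ := hF k
  obtain ⟨N', hN', L', hL', h'⟩ := hF' k
  refine ⟨N' * N, mul_pos hN' hN, L ∩ L', (hL.mul_left N').inter ?_, fun l hl => ?_⟩
  · rw [mul_comm]
    exact hL'.mul_left N
  · exact and_congr (h l fun c hc => hl c (Finset.mem_union_left _ hc))
      (h' l fun c hc => hl c (Finset.mem_union_right _ hc))

theorem IsLimitPeriodic.compl {E : Set (ℤ × ℤ)} (h : IsLimitPeriodic E) :
    IsLimitPeriodic Eᶜ := by
  obtain ⟨F, hF⟩ := h
  refine ⟨F, fun k => ?_⟩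
  obtain ⟨N, hN, L, hL, h⟩ := hF k
  exact ⟨N, hN, Lᶜ, hL.compl, fun l hl => not_congr (h l hl)⟩

theorem isLimitPeriodic_biInter {ι : Type*} {S : Set ι} (hS : S.Finite) {E : ι → Set (ℤ × ℤ)}
    (h : ∀ i ∈ S, IsLimitPeriodic (E i)) : IsLimitPeriodic (⋂ i ∈ S, E i) := by
  induction S, hS using Set.Finite.induction_on with
  | empty =>
    simpa using IsPeriodic.isLimitPeriodic one_pos (L := Set.univ) (fun _ _ => by simp)
  | insert _ _ ih =>
    rw [Set.biInter_insert]
    exact (h _ (Set.mem_insert _ _)).inter (ih fun i hi => h i (Set.mem_insert_of_mem _ hi))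

/-- Removing the lines divisible by `2 ^ (k + 1)` leaves a set of period `2 ^ (k + 2)`. The same `F`
serves all `k`; for `k = 0` every point is excluded. -/
theorem isLimitPeriodic_topU (a w : ℤ) : IsLimitPeriodic {l | topU (a + l.1) (w + l.2)} := by
  refine ⟨{a}, fun k => ?_⟩
  obtain _ | k := k
  · exact ⟨1, one_pos, ∅, fun _ _ => Iff.rfl, fun l hl => absurd (one_dvd _)
      (hl a (Finset.mem_singleton_self a)).1⟩
  · refine ⟨2 ^ (k + 2), by positivity,
      {l | ¬ (2 : ℤ) ^ (k + 1) ∣ a + l.1 ∧ topU (a + l.1) (w + l.2)}, fun l m => ?_, fun l hl => ?_⟩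
    · simp only [cosetPoint, Set.mem_ofPred_eq, ← add_assoc]
      push_cast
      have h1 : (2 : ℤ) ^ (k + 1) ∣ a + l.1 + 2 ^ (k + 2) * m.1 ↔ (2 : ℤ) ^ (k + 1) ∣ a + l.1 :=
        dvd_add_left (Dvd.dvd.mul_right (pow_dvd_pow 2 (by omega)) _)
      rw [h1]
      exact and_congr_right fun h => topU_add_period k _ _ _ _ h
    · have := (hl a (Finset.mem_singleton_self a)).1
      rw [add_comm l.1] at this
      simp only [Set.mem_ofPred_eq, this, not_false_eq_true, true_and]

theorem isLimitPeriodic_topV (w b : ℤ) : IsLimitPeriodic {l | topV (w + l.1) (b + l.2)} := by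
  refine ⟨{b}, fun k => ?_⟩
  obtain _ | k := k
  · exact ⟨1, one_pos, ∅, fun _ _ => Iff.rfl, fun l hl => absurd (one_dvd _)
      (hl b (Finset.mem_singleton_self b)).1⟩
  · refine ⟨2 ^ (k + 2), by positivity,
      {l | ¬ (2 : ℤ) ^ (k + 1) ∣ b + l.2 ∧ topV (w + l.1) (b + l.2)}, fun l m => ?_, fun l hl => ?_⟩
    · simp only [cosetPoint, Set.mem_ofPred_eq, ← add_assoc]
      push_cast
      have h1 : (2 : ℤ) ^ (k + 1) ∣ b + l.2 + 2 ^ (k + 2) * m.2 ↔ (2 : ℤ) ^ (k + 1) ∣ b + l.2 :=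
        dvd_add_left (Dvd.dvd.mul_right (pow_dvd_pow 2 (by omega)) _)
      rw [h1]
      exact and_congr_right fun h => topV_add_period k _ _ _ _ h
    · have := (hl b (Finset.mem_singleton_self b)).2
      rw [add_comm l.2] at this
      simp only [Set.mem_ofPred_eq, this, not_false_eq_true, true_and]

theorem isLimitPeriodic_wins (z : ℤ × ℤ) (e : Fin 4) : IsLimitPeriodic {l | Wins (z + l) e} := by
  fin_cases e <;> simp only [Wins, Prod.fst_add, Prod.snd_add]
  · exact (isLimitPeriodic_topV z.1 z.2).compl
  · simpa only [add_right_comm] using isLimitPeriodic_topU (z.1 + 1) z.2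
  · simpa only [add_right_comm] using isLimitPeriodic_topV z.1 (z.2 + 1)
  · exact (isLimitPeriodic_topU z.1 z.2).compl

theorem isLimitPeriodic_turns (z : ℤ × ℤ) (s : Fin 4) : IsLimitPeriodic {l | turns (z + l) = s} := by
  refine IsPeriodic.isLimitPeriodic (N := 2) (by norm_num) fun l m => ?_
  have h : z + cosetPoint 2 l m = ((z + l).1 + 2 * m.1, (z + l).2 + 2 * m.2) := by
    ext <;> simp [cosetPoint, add_assoc]
  rw [Set.mem_ofPred_eq, h, turns_add_two_mul]
  rfl

theorem card_residues_le (k : ℕ) (F : Finset ℤ) :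
    (residues (2 ^ k) {l | ∃ c ∈ F, (2 : ℤ) ^ k ∣ l.1 + c ∨ (2 : ℤ) ^ k ∣ l.2 + c}).card ≤
      F.card * (2 * 2 ^ k) := by
  classical
  set I : Finset ℤ := Finset.Ico 0 ((2 ^ k : ℕ) : ℤ) with hI
  have hcard : I.card = 2 ^ k := by rw [hI, Int.card_Ico, sub_zero, Int.toNat_natCast]
  have key : ∀ a c : ℤ, 0 ≤ a → a < 2 ^ k → (2 : ℤ) ^ k ∣ a + c → (-c) % 2 ^ k = a := by
    intro a c h0 h1 h2
    obtain ⟨q, hq⟩ := h2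
    rw [show -c = a + 2 ^ k * (-q) by linarith, Int.add_mul_emod_self_left,
      Int.emod_eq_of_lt h0 h1]
  have hsub : residues (2 ^ k) {l | ∃ c ∈ F, (2 : ℤ) ^ k ∣ l.1 + c ∨ (2 : ℤ) ^ k ∣ l.2 + c} ⊆
      F.biUnion fun c => {(-c) % 2 ^ k} ×ˢ I ∪ I ×ˢ {(-c) % 2 ^ k} := by
    intro ρ hρ
    obtain ⟨⟨⟨h1, h2⟩, h3, h4⟩, c, hc, h⟩ := mem_residues.1 hρ
    push_cast at h2 h4
    simp only [Finset.mem_biUnion, Finset.mem_union, Finset.mem_product, Finset.mem_singleton, hI,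
      Finset.mem_Ico]
    push_cast
    refine ⟨c, hc, ?_⟩
    rcases h with h | h
    · exact Or.inl ⟨(key _ _ h1 h2 h).symm, h3, h4⟩
    · exact Or.inr ⟨⟨h1, h2⟩, (key _ _ h3 h4 h).symm⟩
  refine (Finset.card_le_card hsub).trans (Finset.card_biUnion_le_card_mul _ _ _ fun c _ => ?_)
  refine (Finset.card_union_le _ _).trans (le_of_eq ?_)
  rw [Finset.card_product, Finset.card_product, Finset.card_singleton, hcard]
  ring

/-- The normalised counts about the origin are Cauchy, and their limit is close to each approximate
density. -/
theorem exists_hasUniformDensity_of_approx {F : Plane → ℝ → ℝ}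
    (h : ∀ ε > 0, ∃ d, ∀ᶠ r in Filter.atTop, ∀ x, |F x r / (Real.pi * r ^ 2) - d| ≤ ε) :
    ∃ d, HasUniformDensity F d := by
  have hc : Cauchy (Filter.map (fun r => F 0 r / (Real.pi * r ^ 2)) Filter.atTop) := by
    rw [Metric.cauchy_iff]
    refine ⟨inferInstance, fun ε hε => ?_⟩
    obtain ⟨d, hd⟩ := h (ε / 3) (by positivity)
    refine ⟨Metric.closedBall d (ε / 3), ?_, fun a ha b hb => ?_⟩
    · exact Filter.mem_map.2 (hd.mono fun r hr => hr 0)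
    · have h1 := dist_triangle_right a b d
      rw [Metric.mem_closedBall] at ha hb
      linarith
  obtain ⟨d₀, hd₀⟩ := CompleteSpace.complete hc
  refine ⟨d₀, hasUniformDensity_iff.2 fun ε hε => ?_⟩
  obtain ⟨d, hd⟩ := h (ε / 3) (by positivity)
  have h1 : |d₀ - d| ≤ ε / 3 :=
    le_of_tendsto (((show Filter.Tendsto _ _ (nhds d₀) from hd₀).sub_const d).abs)
      (hd.mono fun r hr => hr 0)
  filter_upwards [hd] with r hr x
  have h2 := hr x
  rw [abs_le] at h1 h2
  rw [abs_lt]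
  constructor <;> linarith [h1.1, h1.2, h2.1, h2.2]

theorem IsLimitPeriodic.exists_hasUniformDensity {Φ : ℤ × ℤ → Plane → ℝ → Prop} {D : ℝ}
    (hΦ : IsWindow Φ D) {E : Set (ℤ × ℤ)} (hE : IsLimitPeriodic E) :
    ∃ d, HasUniformDensity (windowCount Φ E) d := by
  obtain ⟨F, hF⟩ := hE
  refine exists_hasUniformDensity_of_approx fun ε hε => ?_
  obtain ⟨k, hk⟩ : ∃ k : ℕ, (F.card : ℝ) / 2 ^ k < ε / 2 := by
    have h1 : Filter.Tendsto (fun k : ℕ => (F.card : ℝ) / 2 ^ k) Filter.atTop (nhds 0) :=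
      tendsto_const_nhds.div_atTop (tendsto_pow_atTop_atTop_of_one_lt (by norm_num))
    exact (h1.eventually (gt_mem_nhds (by positivity : 0 < ε / 2))).exists
  obtain ⟨N, hN, L, hL, hEL⟩ := hF k
  set B : Set (ℤ × ℤ) := {l | ∃ c ∈ F, (2 : ℤ) ^ k ∣ l.1 + c ∨ (2 : ℤ) ^ k ∣ l.2 + c} with hBdef
  have hB : IsPeriodic (2 ^ k) B := by
    intro l m
    have key : ∀ a b c : ℤ, (2 : ℤ) ^ k ∣ a + 2 ^ k * b + c ↔ (2 : ℤ) ^ k ∣ a + c := by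
      intro a b c
      rw [add_right_comm]
      exact dvd_add_left (dvd_mul_right _ _)
    simp only [hBdef, cosetPoint, Set.mem_ofPred_eq]
    push_cast
    simp only [key]
  have hdB : (residues (2 ^ k) B).card * (1 / (2 * ((2 ^ k : ℕ) : ℝ) ^ 2)) ≤ (F.card : ℝ) / 2 ^ k := by
    have h1 : ((residues (2 ^ k) B).card : ℝ) ≤ F.card * (2 * 2 ^ k) := by
      exact_mod_cast card_residues_le k F
    refine (mul_le_mul_of_nonneg_right h1 (by positivity)).trans (le_of_eq ?_)
    push_cast
    field_simp
  -- Error budget: `ε / 4` for `L`, `ε / 4` for `B`, and less than `ε / 2` for the density of `B`.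
  have h1 := hasUniformDensity_iff.1 (hL.hasUniformDensity hΦ hN) (ε / 4) (by positivity)
  have h2 := hasUniformDensity_iff.1 (hB.hasUniformDensity hΦ (by positivity)) (ε / 4)
    (by positivity)
  have hsub : ∀ A A' : Set (ℤ × ℤ), (∀ l, l ∉ B → l ∈ A → l ∈ A') → ∀ x r,
      windowCount Φ A x r ≤ windowCount Φ A' x r + windowCount Φ B x r := by
    intro A A' h x r
    have h3 : {l ∈ A | Φ l x r} ⊆ {l ∈ A' | Φ l x r} ∪ {l ∈ B | Φ l x r} := by
      rintro l ⟨hl, hl'⟩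
      by_cases hb : l ∈ B
      · exact Or.inr ⟨hb, hl'⟩
      · exact Or.inl ⟨h l hb hl, hl'⟩
    have hfin : ({l ∈ A' | Φ l x r} ∪ {l ∈ B | Φ l x r}).Finite :=
      (hΦ.finite x r).subset (by rintro l (hl | hl) <;> exact hl.2)
    unfold windowCount
    exact_mod_cast (Set.ncard_le_ncard h3 hfin).trans (Set.ncard_union_le _ _)
  have hiff : ∀ l, l ∉ B → (l ∈ E ↔ l ∈ L) := by
    intro l hl
    refine hEL l fun c hc => ?_
    rw [← not_or]
    exact fun h => hl ⟨c, hc, h⟩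
  refine ⟨(residues N L).card * (1 / (2 * (N : ℝ) ^ 2)), ?_⟩
  filter_upwards [h1, h2, Filter.eventually_gt_atTop 0] with r hr1 hr2 hr x
  have hpos : 0 < Real.pi * r ^ 2 := by positivity
  have h5 := div_le_div_of_nonneg_right (hsub E L (fun l hl => (hiff l hl).1) x r) hpos.le
  have h6 := div_le_div_of_nonneg_right (hsub L E (fun l hl => (hiff l hl).2) x r) hpos.le
  rw [add_div] at h5 h6
  have h7 := abs_lt.1 (hr1 x)
  have h8 := abs_lt.1 (hr2 x)
  rw [abs_le]
  constructor <;> linarith [h7.1, h7.2, h8.1, h8.2]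

/-! ### Occurrences of patches in the arrowed tiling -/

theorem latticeVec_add (l m : ℤ × ℤ) : latticeVec (l + m) = latticeVec l + latticeVec m := by
  apply plane_ext <;> simp [latticeVec_zero_apply, latticeVec_one_apply] <;> ring

theorem latticeVec_zero : latticeVec 0 = 0 := by
  apply plane_ext <;> simp [latticeVec_zero_apply, latticeVec_one_apply]

theorem Tile.map_add_add (τ : Tile) (s t : Plane) :
    (τ.map (fun v => v + s)).map (fun v => v + t) = τ.map (fun v => v + (s + t)) := by
  rw [Tile.map_map]
  simp only [add_assoc]

theorem Tile.map_add_zero (τ : Tile) : τ.map (fun v => v + 0) = τ := by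
  simp only [add_zero]
  exact τ.map_id

theorem translate_translate (T : Set Tile) (s t : Plane) :
    translate (translate T s) t = translate T (s + t) := by
  simp only [translate, Set.image_image, Tile.map_add_add]

theorem translate_zero (T : Set Tile) : translate T 0 = T := by
  simp only [translate, Tile.map_add_zero, Set.image_id']

theorem translate_injective (t : Plane) : Function.Injective fun T => translate T t := by
  intro T T' h
  have h' := congrArg (fun S => translate S (-t)) h
  simpa only [translate_translate, add_neg_cancel, translate_zero] using h'

theorem ballPatch_translate (T : Set Tile) (t x : Plane) (r : ℝ) :
    ballPatch (translate T t) x r = translate (ballPatch T (x - t) r) t := by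
  have h : ∀ τ : Tile, (τ.map fun v => v + t).support ⊆ Metric.ball x r ↔
      τ.support ⊆ Metric.ball (x - t) r := by
    intro τ
    rw [Tile.map, Set.image_subset_iff]
    refine forall₂_congr fun v _ => ?_
    rw [Set.mem_preimage, Metric.mem_ball, Metric.mem_ball, dist_eq_norm, dist_eq_norm]
    congr! 2
    abel
  ext τ
  constructor
  · rintro ⟨⟨τ, hτ, rfl⟩, h1⟩
    exact ⟨τ, ⟨hτ, (h τ).1 h1⟩, rfl⟩
  · rintro ⟨τ, ⟨hτ, h1⟩, rfl⟩
    exact ⟨⟨τ, hτ, rfl⟩, (h τ).2 h1⟩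

theorem colourOf_injective : Function.Injective colourOf :=
  Function.LeftInverse.injective colourIndex_colourOf

/-- One occurrence fixes the index and direction of the tile; then membership is a single comparison
together with a congruence for the colour. -/
theorem isLimitPeriodic_tile (τ : Tile) :
    IsLimitPeriodic {l | (τ.map fun v => v + latticeVec l) ∈ arrowedTiling} := by
  by_cases h : ∃ l, (τ.map fun v => v + latticeVec l) ∈ arrowedTiling
  · obtain ⟨l₀, h₀⟩ := h
    obtain ⟨z, e, -, hz⟩ := (mem_arrowedTiling_iff _).1 h₀
    convert (isLimitPeriodic_wins (z - l₀) e).inter (isLimitPeriodic_turns (z - l₀) (turns z)) using 1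
    ext l
    have h1 : (τ.map fun v => v + latticeVec l) =
        arrowTile (centre 0 (z - l₀ + l)) e (colourOf (e - turns z)) := by
      rw [show z - l₀ + l = z + (l - l₀) by abel, ← gridTile_map_add, ← hz, Tile.map_add_add,
        ← latticeVec_add, add_sub_cancel]
    rw [Set.mem_ofPred_eq, h1, mem_arrowedTiling_iff]
    constructor
    · rintro ⟨z', e', hw, h2⟩
      obtain ⟨h3, rfl, h4⟩ := arrowTile_inj.1 h2
      obtain rfl := centre_injective _ h3
      exact ⟨hw, (sub_right_injective (colourOf_injective h4)).symm⟩
    · rintro ⟨hw, ht⟩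
      rw [Set.mem_ofPred_eq] at ht
      exact ⟨_, e, hw, by rw [gridTile, ht]⟩
  · push Not at h
    have h1 : {l | (τ.map fun v => v + latticeVec l) ∈ arrowedTiling} = ∅ :=
      Set.eq_empty_iff_forall_notMem.2 h
    rw [h1]
    exact IsPeriodic.isLimitPeriodic one_pos fun _ _ => Iff.rfl

/-- The lattice translations that carry the patch into the arrowed tiling. -/
def occurrences (S : Set Tile) : Set (ℤ × ℤ) :=
  ⋂ τ ∈ S, {l | (τ.map fun v => v + latticeVec l) ∈ arrowedTiling}

/-- The translate of the patch by the lattice vector of `l` lies in the disc. -/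
def PatchWindow (S : Set Tile) (l : ℤ × ℤ) (x : Plane) (r : ℝ) : Prop :=
  ∀ τ ∈ S, (τ.map fun v => v + latticeVec l).support ⊆ Metric.ball x r

theorem translate_subset_ballPatch_iff (S : Set Tile) (l : ℤ × ℤ) (x : Plane) (r : ℝ) :
    translate S (latticeVec l) ⊆ ballPatch arrowedTiling x r ↔
      l ∈ occurrences S ∧ PatchWindow S l x r := by
  simp only [translate, Set.image_subset_iff, occurrences, Set.mem_iInter₂, PatchWindow,
    ← forall₂_and]
  rfl

/-- The tile has the position of a tile of the arrowed tiling. -/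
def IsLatticeTile (τ : Tile) : Prop := ∃ z e c, τ = arrowTile (centre 0 z) e c

theorem exists_isWindow_patchWindow {S : Set Tile} (hS : S.Finite) (hne : S.Nonempty)
    (hl : ∀ τ ∈ S, IsLatticeTile τ) : ∃ D, IsWindow (PatchWindow S) D := by
  obtain ⟨M, hM⟩ := (hS.image fun τ => dist τ.tail 0).bddAbove
  have hb : ∀ τ ∈ S, ∀ v ∈ τ.support, ∀ (l : ℤ × ℤ),
      dist (v + latticeVec l) (latticeVec l) ≤ M + 2 := by
    intro τ hτ v hv l
    have h1 : dist τ.tail 0 ≤ M := hM ⟨τ, hτ, rfl⟩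
    obtain ⟨z, e, c, rfl⟩ := hl τ hτ
    have h2 := dist_le_of_mem_support hv
    have h3 := dist_triangle v (centre 0 z) 0
    have h4 : dist (v + latticeVec l) (latticeVec l) = dist v 0 := by simp [dist_eq_norm]
    have h1' : dist (centre 0 z) 0 ≤ M := h1
    linarith
  refine ⟨M + 2, fun l x r => ⟨fun h τ hτ => ?_, fun h => ?_⟩⟩
  · rintro _ ⟨v, hv, rfl⟩
    have h1 := hb τ hτ v hv l
    have h2 := dist_triangle (v + latticeVec l) (latticeVec l) x
    rw [Metric.mem_ball]
    linarith
  · obtain ⟨τ, hτ⟩ := hne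
    have hv : τ.tail ∈ τ.support := by
      obtain ⟨z, e, c, rfl⟩ := hl τ hτ
      exact tail_mem_support _ _ _
    have h1 := hb τ hτ _ hv l
    have h2 : dist (τ.tail + latticeVec l) x < r := h τ hτ ⟨_, hv, rfl⟩
    have h3 := dist_triangle_left (latticeVec l) x (τ.tail + latticeVec l)
    linarith

/-! ### Lattice-equivariant anchors of patches -/

/-- The first index of the tail of a tile. -/
noncomputable def firstIndex (τ : Tile) : ℤ := ⌊(τ.tail 0 + τ.tail 1 - 1) / 2⌋

/-- The second index of the tail of a tile. -/
noncomputable def secondIndex (τ : Tile) : ℤ := ⌊(τ.tail 0 - τ.tail 1 - 1) / 2⌋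

/-- The pair of the least indices of the tiles of a patch. -/
noncomputable def anchor (S : Set Tile) : ℤ × ℤ := (sInf (firstIndex '' S), sInf (secondIndex '' S))

theorem firstIndex_map_add (τ : Tile) (l : ℤ × ℤ) :
    firstIndex (τ.map fun v => v + latticeVec l) = firstIndex τ + l.1 := by
  rw [firstIndex, firstIndex, ← Int.floor_add_intCast]
  congr 1
  simp only [Tile.map, PiLp.add_apply, latticeVec_zero_apply, latticeVec_one_apply]
  ring

theorem secondIndex_map_add (τ : Tile) (l : ℤ × ℤ) :
    secondIndex (τ.map fun v => v + latticeVec l) = secondIndex τ + l.2 := by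
  rw [secondIndex, secondIndex, ← Int.floor_add_intCast]
  congr 1
  simp only [Tile.map, PiLp.add_apply, latticeVec_zero_apply, latticeVec_one_apply]
  ring

theorem firstIndex_arrowTile (z : ℤ × ℤ) (e : Fin 4) (c : Colour) :
    firstIndex (arrowTile (centre 0 z) e c) = z.1 := by
  rw [firstIndex, ← Int.floor_intCast (R := ℝ) z.1]
  congr 1
  simp only [arrowTile, centre_zero, centre_one]
  ring

theorem secondIndex_arrowTile (z : ℤ × ℤ) (e : Fin 4) (c : Colour) :
    secondIndex (arrowTile (centre 0 z) e c) = z.2 := by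
  rw [secondIndex, ← Int.floor_intCast (R := ℝ) z.2]
  congr 1
  simp only [arrowTile, centre_zero, centre_one]
  ring

theorem sInf_image_translate {S : Set Tile} (hS : S.Finite) (hne : S.Nonempty) (g : Tile → ℤ)
    {t : Plane} {c : ℤ} (hg : ∀ τ, g (τ.map fun v => v + t) = g τ + c) :
    sInf (g '' translate S t) = sInf (g '' S) + c := by
  have h := (OrderIso.addRight c).map_csInf' (hne.image g) (hS.image g).bddBelow
  rw [OrderIso.addRight_apply] at h
  rw [h, translate, Set.image_image, Set.image_image]
  simp only [hg, OrderIso.addRight_apply]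

/-- Equivariance singles out one member of each orbit of a finite nonempty patch under lattice
translations. -/
theorem anchor_translate {S : Set Tile} (hS : S.Finite) (hne : S.Nonempty) (l : ℤ × ℤ) :
    anchor (translate S (latticeVec l)) = anchor S + l := by
  rw [anchor, sInf_image_translate hS hne firstIndex fun τ => firstIndex_map_add τ l,
    sInf_image_translate hS hne secondIndex fun τ => secondIndex_map_add τ l]
  rfl

/-! ### Patch frequencies of the arrowed tiling -/

/-- `S` is a congruent copy of the patch `P`. -/
def IsCopy (P S : Set Tile) : Prop := ∃ f : Plane → Plane, Isometry f ∧ S = Tile.map f '' P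

theorem IsCopy.translate {P S : Set Tile} (h : IsCopy P S) (t : Plane) :
    IsCopy P (translate S t) := by
  obtain ⟨f, hf, rfl⟩ := h
  refine ⟨fun v => f v + t, (IsometryEquiv.addRight t).isometry.comp hf, ?_⟩
  simp only [InductiveRotation.translate, Set.image_image, Tile.map_map]

theorem IsCopy.finite {P S : Set Tile} (h : IsCopy P S) (hP : P.Finite) : S.Finite := by
  obtain ⟨f, -, rfl⟩ := h
  exact hP.image _

theorem IsCopy.nonempty {P S : Set Tile} (h : IsCopy P S) (hP : P.Nonempty) : S.Nonempty := by
  obtain ⟨f, -, rfl⟩ := h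
  exact hP.image _

/-- The copies of `P` that consist of lattice tiles and have their anchor in the origin. -/
def anchoredCopies (P : Set Tile) : Set (Set Tile) :=
  {S | IsCopy P S ∧ anchor S = 0 ∧ ∀ τ ∈ S, IsLatticeTile τ}

/-- Isometries preserve distances between tails. Since some tile has first index 0 and some has
second index 0, all indices are bounded, leaving finitely many lattice tiles. -/
theorem finite_anchoredCopies {P : Set Tile} (hP : P.Finite) (hne : P.Nonempty) :
    (anchoredCopies P).Finite := by
  obtain ⟨M, hM⟩ := ((hP.prod hP).image fun p : Tile × Tile => dist p.1.tail p.2.tail).bddAbove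
  have hM' : ∀ S, IsCopy P S → ∀ τ ∈ S, ∀ τ' ∈ S, dist τ.tail τ'.tail < M + 1 := by
    rintro _ ⟨f, hf, rfl⟩ _ ⟨τ, hτ, rfl⟩ _ ⟨τ', hτ', rfl⟩
    have h1 : dist τ.tail τ'.tail ≤ M := hM ⟨(τ, τ'), ⟨hτ, hτ'⟩, rfl⟩
    have h2 : dist (f τ.tail) (f τ'.tail) < M + 1 := by
      rw [hf.dist_eq]
      linarith
    exact h2
  have hG : ((fun p : (ℤ × ℤ) × Fin 4 × Fin 4 => arrowTile (centre 0 p.1) p.2.1 (colourOf p.2.2)) ''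
      ({z : ℤ × ℤ | |(z.1 : ℝ) - 0| < M + 1 ∧ |(z.2 : ℝ) - 0| < M + 1} ×ˢ Set.univ)).Finite :=
    ((finite_setOf_abs_sub_lt 0 0 (M + 1)).prod Set.finite_univ).image _
  refine hG.finite_subsets.subset ?_
  rintro S ⟨hcopy, hanchor, hlat⟩ τ hτ
  have hSf := hcopy.finite hP
  have hSne := hcopy.nonempty hne
  obtain ⟨τ₁, hτ₁, h1⟩ := Int.csInf_mem (hSne.image firstIndex) (hSf.image firstIndex).bddBelow
  obtain ⟨τ₂, hτ₂, h2⟩ := Int.csInf_mem (hSne.image secondIndex) (hSf.image secondIndex).bddBelow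
  have h1' : firstIndex τ₁ = 0 := h1.trans (congrArg Prod.fst hanchor)
  have h2' : secondIndex τ₂ = 0 := h2.trans (congrArg Prod.snd hanchor)
  have hd1 := hM' S hcopy τ hτ τ₁ hτ₁
  have hd2 := hM' S hcopy τ hτ τ₂ hτ₂
  obtain ⟨z, e, c, rfl⟩ := hlat τ hτ
  obtain ⟨z₁, e₁, c₁, rfl⟩ := hlat τ₁ hτ₁
  obtain ⟨z₂, e₂, c₂, rfl⟩ := hlat τ₂ hτ₂
  rw [firstIndex_arrowTile] at h1'
  rw [secondIndex_arrowTile] at h2'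
  have hb1 := (index_bounds (y := centre 0 z₁) hd1).1
  have hb2 := (index_bounds (y := centre 0 z₂) hd2).2
  have e1 : (centre 0 z₁ 0 + centre 0 z₁ 1 - 1) / 2 = 0 := by
    rw [centre_zero, centre_one, h1']
    push_cast
    ring
  have e2 : (centre 0 z₂ 0 - centre 0 z₂ 1 - 1) / 2 = 0 := by
    rw [centre_zero, centre_one, h2']
    push_cast
    ring
  rw [e1] at hb1
  rw [e2] at hb2
  exact ⟨(z, e, colourIndex c), ⟨⟨hb1, hb2⟩, Set.mem_univ _⟩, by simp only [colourOf_colourIndex]⟩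

theorem finite_ballPatch_arrowedTiling (x : Plane) (r : ℝ) :
    (ballPatch arrowedTiling x r).Finite := by
  have hG : ((fun p : (ℤ × ℤ) × Fin 4 => gridTile p.1 p.2) ''
      ({z : ℤ × ℤ | |(z.1 : ℝ) - (x 0 + x 1 - 1) / 2| < r ∧
        |(z.2 : ℝ) - (x 0 - x 1 - 1) / 2| < r} ×ˢ Set.univ)).Finite :=
    ((finite_setOf_abs_sub_lt _ _ r).prod Set.finite_univ).image _
  refine hG.subset ?_
  rintro τ ⟨hτ, hb⟩
  obtain ⟨z, e, -, rfl⟩ := (mem_arrowedTiling_iff _).1 hτ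
  have hd : dist (centre 0 z) x < r := hb (tail_mem_support _ _ _)
  exact ⟨(z, e), ⟨index_bounds hd, Set.mem_univ _⟩, rfl⟩

theorem copyCount_arrowedTiling {P : Set Tile} (hP : P.Finite) (hne : P.Nonempty) (x : Plane)
    (r : ℝ) : (copyCount arrowedTiling P x r : ℝ) =
      ∑ S ∈ (finite_anchoredCopies hP hne).toFinset,
        windowCount (PatchWindow S) (occurrences S) x r := by
  have hfin : {P' | P' ⊆ ballPatch arrowedTiling x r ∧ IsCopy P P'}.Finite :=
    (finite_ballPatch_arrowedTiling x r).finite_subsets.subset fun P' h => h.1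
  have hback : ∀ P' l, translate (translate P' (latticeVec (-l))) (latticeVec l) = P' := by
    intro P' l
    rw [translate_translate, ← latticeVec_add, neg_add_cancel, latticeVec_zero, translate_zero]
  have hcount : copyCount arrowedTiling P x r =
      {P' | P' ⊆ ballPatch arrowedTiling x r ∧ IsCopy P P'}.ncard := rfl
  rw [hcount, ncard_eq_sum_ncard_fiber hfin (fun P' => translate P' (latticeVec (-anchor P')))
    (finite_anchoredCopies hP hne).toFinset]
  · push_cast
    refine Finset.sum_congr rfl fun S hS => ?_
    obtain ⟨hcopy, hanchor, hlat⟩ := (Set.Finite.mem_toFinset _).1 hS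
    have hSf := hcopy.finite hP
    have hSne := hcopy.nonempty hne
    have hinj : Function.Injective fun l => translate S (latticeVec l) := by
      intro l l' h
      have h' := congrArg anchor h
      simpa only [anchor_translate hSf hSne, add_right_inj] using h'
    rw [windowCount, ← Set.ncard_image_of_injective
      {l | l ∈ occurrences S ∧ PatchWindow S l x r} hinj]
    congr 2
    ext P'
    constructor
    · rintro ⟨⟨h1, h2⟩, rfl⟩
      refine ⟨anchor P', ?_, hback _ _⟩
      refine (translate_subset_ballPatch_iff _ _ _ _).1 ?_
      rwa [hback]
    · rintro ⟨l, hl, rfl⟩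
      refine ⟨⟨(translate_subset_ballPatch_iff _ _ _ _).2 hl, hcopy.translate _⟩, ?_⟩
      simp only [anchor_translate hSf hSne, hanchor, zero_add]
      have := hback S (-l)
      rwa [neg_neg] at this
  · rintro P' ⟨h1, h2⟩
    rw [Set.Finite.mem_toFinset]
    refine ⟨h2.translate _, ?_, ?_⟩
    · rw [anchor_translate (h2.finite hP) (h2.nonempty hne), add_neg_cancel]
    · rintro _ ⟨τ, hτ, rfl⟩
      obtain ⟨z, e, -, rfl⟩ := (mem_arrowedTiling_iff _).1 (h1 hτ).1
      exact ⟨_, _, _, gridTile_map_add _ _ _⟩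

theorem exists_hasUniformDensity_copyCount {P : Set Tile} (hP : P.Finite) :
    ∃ d, HasUniformDensity (fun x r => (copyCount arrowedTiling P x r : ℝ)) d := by
  rcases P.eq_empty_or_nonempty with rfl | hne
  · refine ⟨0, hasUniformDensity_iff.2 fun ε hε => ?_⟩
    -- The empty patch has exactly one copy, itself, so its frequency is 0.
    have h1 : ∀ x r, copyCount arrowedTiling ∅ x r = 1 := by
      intro x r
      rw [copyCount, Set.ncard_eq_one]
      refine ⟨∅, Set.eq_singleton_iff_unique_mem.2 ⟨⟨Set.empty_subset _, id, isometry_id, ?_⟩, ?_⟩⟩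
      · simp
      · rintro P' ⟨-, f, -, rfl⟩
        simp
    have h2 : Filter.Tendsto (fun r : ℝ => 1 / (Real.pi * r ^ 2)) Filter.atTop (nhds 0) :=
      tendsto_const_nhds.div_atTop
        ((Filter.tendsto_pow_atTop two_ne_zero).const_mul_atTop Real.pi_pos)
    filter_upwards [Metric.tendsto_nhds.1 h2 ε hε] with r hr x
    simpa [h1, Real.dist_eq] using hr
  · have h : ∀ S ∈ (finite_anchoredCopies hP hne).toFinset,
        ∃ d, HasUniformDensity (windowCount (PatchWindow S) (occurrences S)) d := by
      intro S hS
      obtain ⟨hcopy, -, hlat⟩ := (Set.Finite.mem_toFinset _).1 hS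
      obtain ⟨D, hD⟩ := exists_isWindow_patchWindow (hcopy.finite hP) (hcopy.nonempty hne) hlat
      exact (isLimitPeriodic_biInter (hcopy.finite hP) fun τ _ =>
        isLimitPeriodic_tile τ).exists_hasUniformDensity hD
    choose! d hd using h
    simp only [copyCount_arrowedTiling hP hne]
    exact ⟨_, HasUniformDensity.sum _ hd⟩

/-! ### From the arrowed tiling to its hull -/

theorem ballPatch_ballPatch {c x : Plane} {R r : ℝ} (h : Metric.ball x r ⊆ Metric.ball c R)
    (T : Set Tile) : ballPatch (ballPatch T c R) x r = ballPatch T x r := by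
  ext τ
  constructor
  · rintro ⟨⟨h1, -⟩, h2⟩
    exact ⟨h1, h2⟩
  · rintro ⟨h1, h2⟩
    exact ⟨⟨h1, h2.trans h⟩, h2⟩

theorem ballPatch_translate_eq_empty {T : Set Tile}
    (hT : ∀ τ ∈ T, ∃ p ∈ τ.support, ∃ q ∈ τ.support, 1 ≤ dist p q) (t x : Plane) :
    ballPatch (translate T t) x (1 / 2) = ∅ := by
  rw [ballPatch_translate, translate, Set.image_eq_empty]
  refine Set.eq_empty_iff_forall_notMem.2 ?_
  rintro τ ⟨hτ, hb⟩
  obtain ⟨p, hp, q, hq, hpq⟩ := hT τ hτ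
  have h1 := Metric.mem_ball.1 (hb hp)
  have h2 := Metric.mem_ball.1 (hb hq)
  have h3 := dist_triangle_right p q (x - t)
  linarith

theorem exists_far_points_arrowTile (p : Plane) (e : Fin 4) (c : Colour) :
    ∃ v ∈ (arrowTile p e c).support, ∃ w ∈ (arrowTile p e c).support, 1 ≤ dist v w := by
  refine ⟨_, head_mem_support p e c, _, tail_mem_support p e c, ?_⟩
  refine le_trans (le_of_eq ?_) (abs_sub_apply_le_dist (p + diagonal e) p 0)
  rw [PiLp.add_apply, add_sub_cancel_left]
  fin_cases e <;> simp [diagonal]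

theorem exists_far_points_of_mem_arrowedTiling {τ : Tile} (h : τ ∈ arrowedTiling) :
    ∃ v ∈ τ.support, ∃ w ∈ τ.support, 1 ≤ dist v w := by
  obtain ⟨z, e, -, rfl⟩ := (mem_arrowedTiling_iff _).1 h
  exact exists_far_points_arrowTile _ _ _

theorem IsTiling.exists_far_points {T : Set Tile} (hT : IsTiling T) {τ : Tile} (h : τ ∈ T) :
    ∃ v ∈ τ.support, ∃ w ∈ τ.support, 1 ≤ dist v w := by
  obtain ⟨c, f, hf, rfl⟩ := hT.1 τ h
  rw [prototile_eq_arrowTile]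
  obtain ⟨v, hv, w, hw, hd⟩ := exists_far_points_arrowTile 0 (colourIndex c) c
  exact ⟨f v, ⟨v, hv, rfl⟩, f w, ⟨w, hw, rfl⟩, by rwa [hf.dist_eq]⟩

theorem exists_agreement_of_tilingDist_lt {T T' : Set Tile} {δ : ℝ}
    (hT : ∀ τ ∈ T, ∃ p ∈ τ.support, ∃ q ∈ τ.support, 1 ≤ dist p q)
    (hT' : ∀ τ ∈ T', ∃ p ∈ τ.support, ∃ q ∈ τ.support, 1 ≤ dist p q)
    (hδ : δ ≤ 1 / √2) (h : tilingDist T T' < δ) :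
    ∃ ε, 0 < ε ∧ ε < δ ∧ ∃ x ∈ Metric.ball (0 : Plane) ε, ∃ y ∈ Metric.ball (0 : Plane) ε,
      ballPatch (translate T x) 0 (1 / ε) = ballPatch (translate T' y) 0 (1 / ε) := by
  have h1 : tilingPreDist T T' < δ := by
    rcases min_lt_iff.1 h with h | h
    · exact h
    · linarith
  have hne : Set.Nonempty {ε : ℝ | 0 < ε ∧ ∃ x ∈ Metric.ball (0 : Plane) ε,
      ∃ y ∈ Metric.ball (0 : Plane) ε,
        ballPatch (translate T x) 0 (1 / ε) = ballPatch (translate T' y) 0 (1 / ε)} :=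
    -- The infimum of the empty set would be 0, so an admissible `ε` is needed: a ball of radius `1
    -- / 2` contains no tile.
    ⟨2, by norm_num, 0, by simp, 0, by simp, by
      rw [ballPatch_translate_eq_empty hT, ballPatch_translate_eq_empty hT']⟩
  obtain ⟨ε, ⟨h2, h3⟩, h4⟩ := exists_lt_of_csInf_lt hne h1
  exact ⟨ε, h2, h4, h3⟩

theorem exists_ballPatch_eq_of_mem_hull {T : Set Tile} (hT : T ∈ hull arrowedTiling) (x : Plane)
    (r : ℝ) : ∃ u, ballPatch T x r = translate (ballPatch arrowedTiling (x - u) r) u := by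
  obtain ⟨hT1, hT2⟩ := hT
  have hK : 0 < |r| + ‖x‖ + 1 := by positivity
  -- This makes the radius of agreement exceed `|r| + ‖x‖ + 1`, where the 1 absorbs the shift `y`;
  -- the bound `1 / √2` keeps the truncation in `tilingDist` inactive.
  set δ : ℝ := min (min (1 / (|r| + ‖x‖ + 1)) 1) (1 / √2) with hδ
  have hδ0 : 0 < δ := by positivity
  obtain ⟨t, ht⟩ := hT2 δ hδ0
  have hA : ∀ τ ∈ translate arrowedTiling t, ∃ p ∈ τ.support, ∃ q ∈ τ.support, 1 ≤ dist p q := by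
    rintro _ ⟨τ, hτ, rfl⟩
    obtain ⟨v, hv, w, hw, hd⟩ := exists_far_points_of_mem_arrowedTiling hτ
    exact ⟨_, ⟨v, hv, rfl⟩, _, ⟨w, hw, rfl⟩, by simpa using hd⟩
  obtain ⟨ε, hε0, hεδ, a, -, y, hy, heq⟩ := exists_agreement_of_tilingDist_lt hA
    (fun τ hτ => hT1.exists_far_points hτ) (min_le_right _ _) ht
  have hε1 : ε < 1 := hεδ.trans_le ((min_le_left _ _).trans (min_le_right _ _))
  have hε2 : |r| + ‖x‖ + 1 < 1 / ε := by
    have h1 : ε < 1 / (|r| + ‖x‖ + 1) := hεδ.trans_le ((min_le_left _ _).trans (min_le_left _ _))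
    rw [lt_div_iff₀ hK] at h1
    rw [lt_div_iff₀ hε0]
    linarith
  rw [mem_ball_zero_iff] at hy
  have hsub : Metric.ball x r ⊆ Metric.ball (0 - y) (1 / ε) := by
    apply Metric.ball_subset_ball'
    have h1 : dist x (0 - y) ≤ ‖x‖ + ‖y‖ := by
      rw [dist_eq_norm, zero_sub, sub_neg_eq_add]
      exact norm_add_le _ _
    linarith [le_abs_self r]
  rw [translate_translate, ballPatch_translate T y] at heq
  have heq' := congrArg (fun S => translate S (-y)) heq
  simp only [translate_translate, add_neg_cancel, translate_zero] at heq'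
  have hmid : ballPatch T (0 - y) (1 / ε) =
      ballPatch (translate arrowedTiling (t + a + -y)) (0 - y) (1 / ε) := by
    rw [← heq', ← translate_translate arrowedTiling (t + a) (-y), ballPatch_translate _ (-y),
      sub_neg_eq_add, sub_add_cancel]
  refine ⟨t + a + -y, ?_⟩
  rw [← ballPatch_translate, ← ballPatch_ballPatch hsub T, hmid, ballPatch_ballPatch hsub]

theorem linearlyRepetitive_of_mem_hull {T : Set Tile} (hT : T ∈ hull arrowedTiling) :
    LinearlyRepetitive T := by
  refine ⟨fun r => 1100 * (r + 1), fun r hr => ⟨by positivity, fun s hs y x => ?_⟩, ?_⟩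
  · obtain ⟨u, hu⟩ := exists_ballPatch_eq_of_mem_hull hT y s
    obtain ⟨w, hw⟩ := exists_ballPatch_eq_of_mem_hull hT x (1100 * (r + 1))
    obtain ⟨l, hl⟩ := exists_translate_ballPatch_subset hr hs (y - u) (x - w)
    refine ⟨-u + (latticeVec l + w), ?_⟩
    rw [hu, hw, translate_translate, add_neg_cancel_left, ← translate_translate]
    exact Set.image_mono hl
  · refine Asymptotics.IsBigO.of_bound 2200 ?_
    filter_upwards [Filter.eventually_ge_atTop 1] with r hr
    rw [Real.norm_of_nonneg (by positivity), Real.norm_of_nonneg (by positivity)]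
    linarith

/-- The centre `x'` depends on `r` as well as on `x`, which is harmless because the convergence for
the arrowed tiling is uniform in the centre. -/
theorem exists_copyCount_eq_of_mem_hull {T : Set Tile} (hT : T ∈ hull arrowedTiling)
    (P : Set Tile) (x : Plane) (r : ℝ) :
    ∃ x', copyCount T P x r = copyCount arrowedTiling P x' r := by
  obtain ⟨u, hu⟩ := exists_ballPatch_eq_of_mem_hull hT x r
  refine ⟨x - u, ?_⟩
  have hback : ∀ S, translate (translate S (-u)) u = S := by
    intro S
    rw [translate_translate, neg_add_cancel, translate_zero]
  have h : {P' | P' ⊆ ballPatch T x r ∧ IsCopy P P'} = (fun S => translate S u) ''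
      {P' | P' ⊆ ballPatch arrowedTiling (x - u) r ∧ IsCopy P P'} := by
    ext P'
    rw [hu]
    constructor
    · rintro ⟨h1, h2⟩
      refine ⟨translate P' (-u), ⟨?_, h2.translate _⟩, hback P'⟩
      have h3 : translate P' (-u) ⊆ translate (translate (ballPatch arrowedTiling (x - u) r) u) (-u) :=
        Set.image_mono h1
      rwa [translate_translate, add_neg_cancel, translate_zero] at h3
    · rintro ⟨S, ⟨h1, h2⟩, rfl⟩
      exact ⟨Set.image_mono h1, h2.translate _⟩
  exact (congrArg Set.ncard h).trans (Set.ncard_image_of_injective _ (translate_injective u))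

theorem uniformPatchFrequencies_of_mem_hull {T : Set Tile} (hT : T ∈ hull arrowedTiling) :
    UniformPatchFrequencies T := by
  intro P hP _
  obtain ⟨d, hd⟩ := exists_hasUniformDensity_copyCount hP
  refine ⟨d, (hasUniformDensity_iff (F := fun x r => (copyCount T P x r : ℝ))).2 fun ε hε => ?_⟩
  filter_upwards [hasUniformDensity_iff.1 hd ε hε] with r hr x
  obtain ⟨x', hx'⟩ := exists_copyCount_eq_of_mem_hull hT P x r
  rw [hx']
  exact hr x'

end InductiveRotation

theorem corollary3p5 (T : Set InductiveRotation.Tile)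
    (hT : T ∈ InductiveRotation.hull InductiveRotation.arrowedTiling) :
    InductiveRotation.LinearlyRepetitive T ∧ InductiveRotation.UniformPatchFrequencies T :=
  ⟨InductiveRotation.linearlyRepetitive_of_mem_hull hT,
    InductiveRotation.uniformPatchFrequencies_of_mem_hull hT⟩
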